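/- A compact pair $(G,\alpha)$ is a compact (Hausdorff) topological group $G$ with a topological automorphism $\alpha$ of $G$; a subgroup $H$ is $\alpha$-stable if $\alpha(H)=H$. The pair $(G,\alpha)$ is topologically transitive if some orbit $\{\alpha^n(x)\mid n\in\mathbb Z\}$ is dense in $G$. It has finite depth if there is an open subgroup $V\le G$ with $\bigcap_{k\in\mathbb Z}\alpha^k(V)=\{1\}$. It is irreducible if $G$ is infinite and every proper, closed, normal, $\alpha$-stable subgroup of $G$ is finite. For a finite group $F$, the shift $(F^{\mathbb Z},\sigma)$ is the product group with the product topology and $\sigma(f)(n)=f(n+1)$. Two pairs are isomorphic if there is an isomorphism of topological groups between them that intertwines the automorphisms. Compact pairs $(G_1,\alpha_1)$ and $(G_2,\alpha_2)$ are co-commensurable if there are a compact pair $(K,\kappa)$ and continuous surjective homomorphisms $\varphi_i:K\to G_i$ with finite kernels such that $\varphi_i\circ\kappa=\alpha_i\circ\varphi_i$ $(i=1,2)$. A subnormal series of length $r\ge 0$ for $(G,\alpha)$ is a sequence $\{1\}=G_0\le G_1\le\cdots\le G_r=G$ of closed, $\alpha$-stable subgroups such that every $\alpha|_{G_j}$ is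 topologically transitive and, for $1\le j\le r$, $G_{j-1}$ is normal in $G_j$ and the automorphism $\alpha_j$ induced by $\alpha$ on $G_j/G_{j-1}$ is topologically transitive. Its subquotients are the pairs $(G_j/G_{j-1},\alpha_j)$, $1\le j\le r$. It is a composition series if all its subquotients are irreducible. Theorem 6.16. Let $(G,\alpha)$ be a topologically transitive compact pair of finite depth. Then: (1) $(G,\alpha)$ has a composition series. (2) Every subquotient of every composition series for $(G,\alpha)$ is isomorphic to a shift $(F^{\mathbb Z},\sigma)$ for some finite simple group $F$. (3) Any two composition series $(G_j)_{0\le j\le r}$ and $(H_j)_{0\le j\le s}$ for $(G,\alpha)$ are equivalent: $r=s$, and there is a permutation $\pi$ of $\{1,\dots,r\}$ such that the $j$th subquotient of $(G_j)$ and the $\pi(j)$th subquotient of $(H_j)$ are co-commensurable for each $j$. -/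

import Mathlib

universe u

/-- A compact pair `(G, α)`: a compact (Hausdorff) topological group `G` together with a
topological group automorphism `α` of `G`. -/
structure CompactPair where
  /-- the underlying compact group -/
  carrier : Type u
  [group : Group carrier]
  [topologicalSpace : TopologicalSpace carrier]
  [isTopologicalGroup : IsTopologicalGroup carrier]
  [compactSpace : CompactSpace carrier]
  [t2Space : T2Space carrier]
  /-- the automorphism -/
  aut : carrier ≃ₜ* carrier

namespace CompactPair

attribute [instance] group topologicalSpace isTopologicalGroup compactSpace t2Space

instance : CoeSort CompactPair.{u} (Type u) := ⟨carrier⟩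

/-- The integer power `α ^ k` of the automorphism, in the automorphism group of the abstract
group `G`. -/
def autPow (P : CompactPair.{u}) (k : ℤ) : MulAut P :=
  (P.aut.toMulEquiv : MulAut P) ^ k

/-- `(G, α)` is topologically transitive: some two-sided orbit `{α ^ n x | n ∈ ℤ}` is dense. -/
def IsTopologicallyTransitive (P : CompactPair.{u}) : Prop :=
  ∃ x : P, Dense (Set.range fun n : ℤ => P.autPow n x)

/-- `(G, α)` has finite depth: there is an open subgroup `V` with `⋂ k ∈ ℤ, α ^ k (V) = {1}`. -/
def HasFiniteDepth (P : CompactPair.{u}) : Prop :=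
  ∃ V : Subgroup P, IsOpen (V : Set P) ∧
    ⨅ k : ℤ, V.map (P.autPow k).toMonoidHom = ⊥

/-- A closed subgroup `H` of `G` that is `α`-stable: `α (H) = H`. -/
structure StableSubgroup (P : CompactPair.{u}) where
  /-- the underlying subgroup -/
  toSubgroup : Subgroup P
  isClosed : IsClosed (toSubgroup : Set P)
  map_eq : toSubgroup.map P.aut.toMulEquiv.toMonoidHom = toSubgroup

theorem StableSubgroup.apply_mem_iff {P : CompactPair.{u}} (H : P.StableSubgroup) (x : P) :
    P.aut x ∈ H.toSubgroup ↔ x ∈ H.toSubgroup := by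
  constructor
  · intro hx
    rw [← H.map_eq] at hx
    obtain ⟨y, hy, hyx⟩ := hx
    have : y = x := P.aut.injective hyx
    exact this ▸ hy
  · intro hx
    rw [← H.map_eq]
    exact ⟨x, hx, rfl⟩

theorem StableSubgroup.symm_mem {P : CompactPair.{u}} (H : P.StableSubgroup) {x : P}
    (hx : x ∈ H.toSubgroup) : P.aut.symm x ∈ H.toSubgroup := by
  rw [← H.apply_mem_iff, P.aut.apply_symm_apply]
  exact hx

/-- The restriction `(H, α|_H)` of a compact pair to a closed `α`-stable subgroup `H`. -/
def restrict (P : CompactPair.{u}) (H : P.StableSubgroup) : CompactPair.{u} where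
  carrier := H.toSubgroup
  compactSpace := isCompact_iff_compactSpace.mp H.isClosed.isCompact
  aut :=
    { toFun := fun x => ⟨P.aut x, (H.apply_mem_iff x).mpr x.2⟩
      invFun := fun x => ⟨P.aut.symm x, H.symm_mem x.2⟩
      left_inv := fun x => Subtype.ext (P.aut.symm_apply_apply x)
      right_inv := fun x => Subtype.ext (P.aut.apply_symm_apply x)
      map_mul' := fun x y => Subtype.ext (map_mul P.aut (x : P) y)
      continuous_toFun := (P.aut.continuous.comp continuous_subtype_val).subtype_mk _
      continuous_invFun := (P.aut.symm.continuous.comp continuous_subtype_val).subtype_mk _ }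

/-- The quotient pair `(G/N, α|^{G/N})` of a compact pair by a closed normal `α`-stable subgroup
`N`, with `G/N` carrying the quotient topology. -/
def quotient (P : CompactPair.{u}) (N : P.StableSubgroup) (hN : N.toSubgroup.Normal) :
    CompactPair.{u} :=
  letI := hN
  haveI : IsClosed (N.toSubgroup : Set P) := N.isClosed
  { carrier := P ⧸ N.toSubgroup
    aut :=
      { QuotientGroup.congr N.toSubgroup N.toSubgroup P.aut.toMulEquiv N.map_eq with
        continuous_toFun := by
          refine (QuotientGroup.isQuotientMap_mk N.toSubgroup).continuous_iff.mpr ?_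
          exact QuotientGroup.continuous_mk.comp P.aut.continuous
        continuous_invFun := by
          refine (QuotientGroup.isQuotientMap_mk N.toSubgroup).continuous_iff.mpr ?_
          exact QuotientGroup.continuous_mk.comp P.aut.symm.continuous } }

/-- For closed `α`-stable subgroups `A` and `B` of `G`, the subgroup `A ∩ B` of `B`, as a closed
stable subgroup of the pair `(B, α|_B)`. It is used when `A ≤ B`. -/
def StableSubgroup.subgroupOf {P : CompactPair.{u}} (A B : P.StableSubgroup) :
    (P.restrict B).StableSubgroup where
  toSubgroup := A.toSubgroup.subgroupOf B.toSubgroup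
  isClosed := A.isClosed.preimage continuous_subtype_val
  map_eq := by
    ext x
    constructor
    · rintro ⟨y, hy, rfl⟩
      exact (A.apply_mem_iff (y : B.toSubgroup).1).mpr hy
    · intro hx
      exact ⟨(P.restrict B).aut.symm x, A.symm_mem hx, (P.restrict B).aut.apply_symm_apply x⟩

/-- `(G, α)` is irreducible: `G` is infinite, and every proper, closed, normal, `α`-stable
subgroup of `G` is finite. -/
def IsIrreducible (P : CompactPair.{u}) : Prop :=
  Infinite P ∧
    ∀ N : P.StableSubgroup, N.toSubgroup.Normal → N.toSubgroup ≠ ⊤ → Finite N.toSubgroup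

/-- Isomorphism of compact pairs: an isomorphism of topological groups that intertwines the
automorphisms. -/
def IsIsomorphic (P Q : CompactPair.{u}) : Prop :=
  ∃ e : P ≃ₜ* Q, ∀ x, e (P.aut x) = Q.aut (e x)

/-- Compact pairs `(G₁, α₁)` and `(G₂, α₂)` are co-commensurable if there are a compact pair
`(G, α)` and continuous surjective homomorphisms `φᵢ : G → Gᵢ` with finite kernels such that
`φᵢ ∘ α = αᵢ ∘ φᵢ`. -/
def CoCommensurable (P₁ P₂ : CompactPair.{u}) : Prop :=
  ∃ (P : CompactPair.{u}) (φ₁ : P →ₜ* P₁) (φ₂ : P →ₜ* P₂),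
    (Function.Surjective φ₁ ∧ Finite φ₁.toMonoidHom.ker ∧ ∀ x, φ₁ (P.aut x) = P₁.aut (φ₁ x)) ∧
    (Function.Surjective φ₂ ∧ Finite φ₂.toMonoidHom.ker ∧ ∀ x, φ₂ (P.aut x) = P₂.aut (φ₂ x))

/-- The shift `(F^ℤ, σ)` over a finite group `F`: the product group `ℤ → F` with the product of the
discrete topologies, and `σ (f) (n) = f (n + 1)`. -/
def shift (F : Type u) [Group F] [Finite F] : CompactPair.{u} :=
  letI : TopologicalSpace F := ⊥
  haveI : DiscreteTopology F := ⟨rfl⟩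
  { carrier := ℤ → F
    aut :=
      { toFun := fun f n => f (n + 1)
        invFun := fun f n => f (n - 1)
        left_inv := fun f => funext fun n => congrArg f (sub_add_cancel n 1)
        right_inv := fun f => funext fun n => congrArg f (add_sub_cancel_right n 1)
        map_mul' := fun _ _ => rfl
        continuous_toFun := continuous_pi fun n => continuous_apply (n + 1)
        continuous_invFun := continuous_pi fun n => continuous_apply (n - 1) } }

/-- A subnormal series for `(G, α)`: an increasing sequence `{1} = G₀ ≤ G₁ ≤ ⋯ ≤ G_r = G` of
closed, `α`-stable, topologically transitive subgroups such that each `G_j` is normal in `G_{j+1}`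
and the pair induced on `G_{j+1}/G_j` is topologically transitive. -/
structure SubnormalSeries (P : CompactPair.{u}) where
  /-- the length `r` of the series -/
  length : ℕ
  /-- the terms of the series -/
  term : Fin (length + 1) → P.StableSubgroup
  term_zero : (term 0).toSubgroup = ⊥
  term_last : (term (Fin.last length)).toSubgroup = ⊤
  le : ∀ j : Fin length, (term j.castSucc).toSubgroup ≤ (term j.succ).toSubgroup
  normal : ∀ j : Fin length,
    ((term j.castSucc).subgroupOf (term j.succ)).toSubgroup.Normal
  transitive : ∀ j, (P.restrict (term j)).IsTopologicallyTransitive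
  transitive_quotient : ∀ j : Fin length,
    ((P.restrict (term j.succ)).quotient ((term j.castSucc).subgroupOf (term j.succ))
      (normal j)).IsTopologicallyTransitive

namespace SubnormalSeries

variable {P : CompactPair.{u}}

/-- The subquotient `(G_{j+1}/G_j, α_{j+1})`, for `j = 0, …, r - 1`, of a subnormal series. -/
def subquotient (S : P.SubnormalSeries) (j : Fin S.length) : CompactPair.{u} :=
  (P.restrict (S.term j.succ)).quotient ((S.term j.castSucc).subgroupOf (S.term j.succ))
    (S.normal j)

/-- Two subnormal series are equivalent if they have the same length and, up to a permutation,
co-commensurable subquotients. -/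
def Equivalent (S T : P.SubnormalSeries) : Prop :=
  S.length = T.length ∧
    ∃ π : Fin S.length ≃ Fin T.length,
      ∀ j, CoCommensurable (S.subquotient j) (T.subquotient (π j))

/-- A composition series is a subnormal series all of whose subquotients are irreducible. -/
def IsComposition (S : P.SubnormalSeries) : Prop :=
  ∀ j, (S.subquotient j).IsIrreducible

end SubnormalSeries

end CompactPair

/-! Finite depth yields an open normal subgroup whose translates meet trivially. Reading an element
modulo these translates embeds `G` as a closed shift-invariant group of sequences over a finite
group (`Coding`).

The invariant that makes everything finite is `leading`: the group of symbols that can follow a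
trivial left half-line. If closed stable `T ≤ H` have the same leading symbols, then `T` has finite
index in `H` (`relIndex_ne_zero_of_leading_le`). The closure of the homoclinic elements of `H`, its
`core`, has all leading symbols of `H`, hence finite index. A transitive group has no proper closed
stable subgroup of finite index, and dense homoclinic elements give transitivity by a Baire
argument. So a closed stable subgroup is transitive exactly when it equals its core, and the number
of leading symbols increases strictly along chains of transitive subgroups.

Existence follows by induction on that number. Uniqueness is the Jordan–Hölder theorem in the
lattice of transitive subgroups, where the join is the closed join and the meet is the core of the
intersection. As the core has only finite index there, the second isomorphism theorem holds up to a
finite kernel (`exists_isFiniteCover_core_inter`), which is why co-commensurability appears.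

An irreducible subquotient again has a coding. Let `m` be the least length of an interval supporting
a nontrivial element. The elements supported on intervals of length `m` generate a dense subgroup,
by irreducibility. Let `N` be the closed subgroup generated by all translates of the elements
supported in `[0, m)` except the untranslated ones. Minimality of `m` makes the translates of `N`
intersect trivially, so the pair is the full shift over the finite group `G / N`; irreducibility
makes `G / N` simple. -/

namespace CompactPair

/-! ### Powers of the automorphism, stable subgroups, transitivity -/

variable {P : CompactPair.{u}}

theorem autPow_add (i j : ℤ) (x : P) : P.autPow (i + j) x = P.autPow i (P.autPow j x) := by
  simp [autPow, zpow_add]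

@[simp] theorem autPow_zero (x : P) : P.autPow 0 x = x := by
  simp [autPow]

@[simp] theorem autPow_one (x : P) : P.autPow 1 x = P.aut x := by
  rw [autPow, zpow_one]
  rfl

theorem autPow_autPow (i j : ℤ) (x : P) :
    P.autPow i (P.autPow j x) = P.autPow (i + j) x := (autPow_add i j x).symm

/-- An equivariant homomorphism intertwines all powers of the automorphisms. -/
theorem map_autPow {Q : CompactPair.{u}} (φ : P →* Q) (h : ∀ x, φ (P.aut x) = Q.aut (φ x))
    (k : ℤ) (x : P) : φ (P.autPow k x) = Q.autPow k (φ x) := by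
  induction k using Int.induction_on generalizing x with
  | zero => simp
  | succ n ih => rw [autPow_add, autPow_add, ih, autPow_one, autPow_one, h]
  | pred n ih =>
    apply Q.aut.injective
    rw [← h, ← autPow_one, ← autPow_one, autPow_autPow, autPow_autPow]
    have : (1 : ℤ) + (-n - 1) = -n := by ring
    rw [this, ih]

theorem continuous_autPow (k : ℤ) : Continuous (P.autPow k) := by
  induction k using Int.induction_on with
  | zero => exact continuous_id.congr fun x => (autPow_zero x).symm
  | succ n ih =>
    refine (ih.comp P.aut.continuous).congr fun x => ?_
    rw [autPow_add, autPow_one]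
    rfl
  | pred n ih =>
    refine (ih.comp P.aut.symm.continuous).congr fun x => ?_
    obtain ⟨y, rfl⟩ := P.aut.surjective x
    have h : P.aut.symm (P.aut y) = y := P.aut.symm_apply_apply y
    change P.autPow (-n) (P.aut.symm (P.aut y)) = _
    rw [h, ← autPow_one, autPow_autPow, sub_add_cancel]

theorem StableSubgroup.autPow_mem_iff (H : P.StableSubgroup) (k : ℤ) (x : P) :
    P.autPow k x ∈ H.toSubgroup ↔ x ∈ H.toSubgroup := by
  induction k using Int.induction_on generalizing x with
  | zero => simp
  | succ n ih => rw [autPow_add, ih, autPow_one, H.apply_mem_iff]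
  | pred n ih =>
    rw [← H.apply_mem_iff, ← autPow_one, autPow_autPow]
    have : (1 : ℤ) + (-n - 1) = -n := by ring
    rw [this, ih]

@[ext] theorem StableSubgroup.ext {A B : P.StableSubgroup} (h : A.toSubgroup = B.toSubgroup) :
    A = B := by
  cases A; cases B; cases h; rfl

/-- The closed stable subgroup with a given carrier whose membership is invariant. -/
def StableSubgroup.mk' (H : Subgroup P) (hc : IsClosed (H : Set P))
    (h : ∀ k x, x ∈ H → P.autPow k x ∈ H) : P.StableSubgroup where
  toSubgroup := H
  isClosed := hc
  map_eq := by
    ext x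
    constructor
    · rintro ⟨y, hy, rfl⟩
      exact autPow_one y ▸ h 1 y hy
    · intro hx
      refine ⟨P.autPow (-1) x, h (-1) x hx, ?_⟩
      change P.aut (P.autPow (-1) x) = x
      rw [← autPow_one, autPow_autPow]
      simp

theorem StableSubgroup.map_autPow_eq (H : P.StableSubgroup) (k : ℤ) :
    H.toSubgroup.map (P.autPow k).toMonoidHom = H.toSubgroup := by
  ext x
  constructor
  · rintro ⟨y, hy, rfl⟩
    exact (H.autPow_mem_iff k y).2 hy
  · intro hx
    refine ⟨P.autPow (-k) x, (H.autPow_mem_iff _ x).2 hx, ?_⟩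
    change P.autPow k (P.autPow (-k) x) = x
    rw [autPow_autPow]
    simp

/-- The inclusion of a closed stable subgroup. -/
def incl (H : P.StableSubgroup) : P.restrict H →ₜ* P where
  toMonoidHom := H.toSubgroup.subtype
  continuous_toFun := continuous_subtype_val

theorem incl_aut (H : P.StableSubgroup) (x : P.restrict H) :
    incl H ((P.restrict H).aut x) = P.aut (incl H x) := rfl

theorem coe_autPow_restrict (H : P.StableSubgroup) (k : ℤ) (x : P.restrict H) :
    incl H ((P.restrict H).autPow k x) = P.autPow k (incl H x) :=
  map_autPow (incl H).toMonoidHom (incl_aut H) k x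

theorem incl_injective (H : P.StableSubgroup) : Function.Injective (incl H) :=
  Subtype.val_injective

theorem incl_mem (H : P.StableSubgroup) (x : P.restrict H) : incl H x ∈ H.toSubgroup := x.2

theorem exists_incl_eq (H : P.StableSubgroup) {x : P} (hx : x ∈ H.toSubgroup) :
    ∃ y, incl H y = x := ⟨⟨x, hx⟩, rfl⟩

/-- The quotient map of a compact pair. -/
def proj (N : P.StableSubgroup) (hN : N.toSubgroup.Normal) : P →ₜ* P.quotient N hN :=
  letI := hN
  { toMonoidHom := QuotientGroup.mk' N.toSubgroup
    continuous_toFun := QuotientGroup.continuous_mk }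

theorem proj_surjective (N : P.StableSubgroup) (hN : N.toSubgroup.Normal) :
    Function.Surjective (proj N hN) :=
  letI := hN
  QuotientGroup.mk'_surjective N.toSubgroup

theorem proj_aut (N : P.StableSubgroup) (hN : N.toSubgroup.Normal) (x : P) :
    proj N hN (P.aut x) = (P.quotient N hN).aut (proj N hN x) := rfl

theorem ker_proj (N : P.StableSubgroup) (hN : N.toSubgroup.Normal) :
    (proj N hN).toMonoidHom.ker = N.toSubgroup :=
  letI := hN
  QuotientGroup.ker_mk' N.toSubgroup

theorem proj_eq_one_iff (N : P.StableSubgroup) (hN : N.toSubgroup.Normal) (x : P) :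
    proj N hN x = 1 ↔ x ∈ N.toSubgroup := by
  rw [← ker_proj N hN]; rfl

theorem isOpenMap_proj (N : P.StableSubgroup) (hN : N.toSubgroup.Normal) :
    IsOpenMap (proj N hN) :=
  letI := hN
  QuotientGroup.isOpenMap_coe

/-- The image of a closed stable subgroup under a continuous equivariant homomorphism. -/
def StableSubgroup.map {Q : CompactPair.{u}} (φ : P →ₜ* Q) (hφ : ∀ x, φ (P.aut x) = Q.aut (φ x))
    (H : P.StableSubgroup) : Q.StableSubgroup :=
  .mk' (H.toSubgroup.map φ.toMonoidHom)
    (by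
      rw [Subgroup.coe_map]
      exact (H.isClosed.isCompact.image φ.continuous).isClosed)
    (by
      rintro k _ ⟨x, hx, rfl⟩
      exact ⟨P.autPow k x, (H.autPow_mem_iff k x).2 hx, map_autPow φ.toMonoidHom hφ k x⟩)

/-- The preimage of a closed stable subgroup under a continuous equivariant homomorphism. -/
def StableSubgroup.comap {Q : CompactPair.{u}} (φ : P →ₜ* Q)
    (hφ : ∀ x, φ (P.aut x) = Q.aut (φ x)) (H : Q.StableSubgroup) : P.StableSubgroup :=
  .mk' (H.toSubgroup.comap φ.toMonoidHom) (H.isClosed.preimage φ.continuous)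
    (by
      intro k x hx
      rw [Subgroup.mem_comap] at hx ⊢
      rw [map_autPow φ.toMonoidHom hφ]
      exact (H.autPow_mem_iff k _).2 hx)

/-- The topological closure of an invariant subgroup is stable. -/
def StableSubgroup.closure (H : Subgroup P) (h : ∀ k x, x ∈ H → P.autPow k x ∈ H) :
    P.StableSubgroup :=
  .mk' H.topologicalClosure H.isClosed_topologicalClosure fun k _ hx =>
    map_mem_closure (continuous_autPow k) hx (h k)

/-- The intersection of two closed stable subgroups. -/
def StableSubgroup.inter (A B : P.StableSubgroup) : P.StableSubgroup :=
  .mk' (A.toSubgroup ⊓ B.toSubgroup) (A.isClosed.inter B.isClosed) fun k x hx =>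
    ⟨(A.autPow_mem_iff k x).2 hx.1, (B.autPow_mem_iff k x).2 hx.2⟩

/-- The join of two closed stable subgroups. -/
def StableSubgroup.join (A B : P.StableSubgroup) : P.StableSubgroup :=
  .closure (A.toSubgroup ⊔ B.toSubgroup) fun k x hx => by
    have h : (A.toSubgroup ⊔ B.toSubgroup).map (P.autPow k).toMonoidHom =
        A.toSubgroup ⊔ B.toSubgroup := by
      rw [Subgroup.map_sup, A.map_autPow_eq, B.map_autPow_eq]
    rw [← h]
    exact ⟨x, hx, rfl⟩

/-- The trivial subgroup. -/
def StableSubgroup.bot (P : CompactPair.{u}) : P.StableSubgroup :=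
  .mk' ⊥ (by simp) fun _ _ hx => by
    rw [Subgroup.mem_bot] at hx ⊢
    rw [hx, map_one]

/-- The whole group. -/
def StableSubgroup.top (P : CompactPair.{u}) : P.StableSubgroup :=
  .mk' ⊤ isClosed_univ fun _ _ _ => Subgroup.mem_top _

/-- The image of a transitive pair is transitive. -/
theorem IsTopologicallyTransitive.map {Q : CompactPair.{u}} (hP : P.IsTopologicallyTransitive)
    (φ : P →ₜ* Q) (hφ : ∀ x, φ (P.aut x) = Q.aut (φ x)) (hs : Function.Surjective φ) :
    Q.IsTopologicallyTransitive := by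
  obtain ⟨x, hx⟩ := hP
  refine ⟨φ x, ?_⟩
  have := hs.denseRange.dense_image φ.continuous hx
  rw [← Set.range_comp] at this
  convert this using 3 with k
  exact (map_autPow φ.toMonoidHom hφ k x).symm

/-- A dense orbit meets the open set `N`; by stability the whole orbit lies in `N`, and `N` is
closed. -/
theorem IsTopologicallyTransitive.eq_top_of_isOpen (hP : P.IsTopologicallyTransitive)
    (N : P.StableSubgroup) (hN : IsOpen (N.toSubgroup : Set P)) : N.toSubgroup = ⊤ := by
  obtain ⟨x, hx⟩ := hP
  obtain ⟨_, hy, k, rfl⟩ := hx.inter_open_nonempty _ hN ⟨1, N.toSubgroup.one_mem⟩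
  have hxN : x ∈ N.toSubgroup := (N.autPow_mem_iff k x).1 hy
  rw [← SetLike.coe_set_eq, Subgroup.coe_top, ← Set.univ_subset_iff, ← hx.closure_eq]
  refine closure_minimal ?_ N.isClosed
  rintro _ ⟨k, rfl⟩
  exact (N.autPow_mem_iff k x).2 hxN

theorem IsTopologicallyTransitive.eq_top_of_finiteIndex (hP : P.IsTopologicallyTransitive)
    (N : P.StableSubgroup) (hN : N.toSubgroup.FiniteIndex) : N.toSubgroup = ⊤ :=
  hP.eq_top_of_isOpen N (Subgroup.isOpen_of_isClosed_of_finiteIndex _ N.isClosed)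

theorem IsTopologicallyTransitive.eq_of_relIndex_ne_zero {A B : P.StableSubgroup}
    (hB : (P.restrict B).IsTopologicallyTransitive) (hAB : A.toSubgroup ≤ B.toSubgroup)
    (h : A.toSubgroup.relIndex B.toSubgroup ≠ 0) : A = B := by
  have := hB.eq_top_of_finiteIndex (A.subgroupOf B) ⟨h⟩
  exact StableSubgroup.ext (le_antisymm hAB (Subgroup.subgroupOf_eq_top.1 this))

/-- A subgroup of finite relative index that is mapped into itself by a power of the automorphism
is invariant under this power. -/
theorem map_autPow_eq_of_le {H : P.StableSubgroup} {S : Subgroup P} (hSH : S ≤ H.toSubgroup)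
    (hfin : S.relIndex H.toSubgroup ≠ 0) {k : ℤ} (hk : S.map (P.autPow k).toMonoidHom ≤ S) :
    S.map (P.autPow k).toMonoidHom = S := by
  -- The automorphism preserves `H`, so the image of `S` has the same finite index in `H` as `S`;
  -- multiplicativity then makes its index in `S` equal to 1.
  have h1 : (S.map (P.autPow k).toMonoidHom).relIndex H.toSubgroup = S.relIndex H.toSubgroup := by
    conv_lhs => rw [← H.map_autPow_eq k]
    exact Subgroup.relIndex_map_map_of_injective _ _ (P.autPow k).injective
  have h2 := Subgroup.relIndex_mul_relIndex _ _ _ hk hSH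
  rw [h1] at h2
  have h3 : (S.map (P.autPow k).toMonoidHom).relIndex S = 1 := by
    have := Nat.pos_of_ne_zero hfin
    nlinarith
  exact le_antisymm hk (Subgroup.relIndex_eq_one.1 h3)

end CompactPair

/-! ### Codings by sequences over a finite group, homoclinic elements -/

namespace CompactPair

/-- An open normal subgroup whose images under the powers of the automorphism intersect
trivially. It codes the elements of the group by bi-infinite sequences in a finite group. -/
structure Coding (P : CompactPair.{u}) where
  /-- the open normal subgroup -/
  window : Subgroup P
  normal : window.Normal
  isOpen : IsOpen (window : Set P)
  eq_one : ∀ x, (∀ i : ℤ, P.autPow i x ∈ window) → x = 1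

namespace Coding

attribute [instance] Coding.normal

variable {P : CompactPair.{u}} (C : P.Coding)

instance : DiscreteTopology (P ⧸ C.window) := QuotientGroup.discreteTopology C.isOpen

instance : Finite (P ⧸ C.window) := Subgroup.quotient_finite_of_isOpen _ C.isOpen

/-- The `i`th coordinate of an element. -/
def coord (i : ℤ) : P →* P ⧸ C.window :=
  (QuotientGroup.mk' C.window).comp (P.autPow i).toMonoidHom

theorem coord_autPow (i k : ℤ) (x : P) : C.coord i (P.autPow k x) = C.coord (i + k) x := by
  change QuotientGroup.mk _ = QuotientGroup.mk _
  exact congrArg _ (autPow_add i k x).symm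

theorem continuous_coord (i : ℤ) : Continuous (C.coord i) :=
  QuotientGroup.continuous_mk.comp (continuous_autPow i)

theorem eq_one_of_coord {x : P} (h : ∀ i, C.coord i x = 1) : x = 1 :=
  C.eq_one x fun i => (QuotientGroup.eq_one_iff _).1 (h i)

theorem coord_injective : Function.Injective fun (x : P) (i : ℤ) => C.coord i x := by
  intro x y h
  have : x⁻¹ * y = 1 := C.eq_one_of_coord fun i => by
    rw [map_mul, map_inv, inv_mul_eq_one]
    exact congrFun h i
  exact inv_mul_eq_one.1 this

/-- The subgroup of the elements whose coordinates with index in `S` are trivial. -/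
def kerOn (S : Set ℤ) : Subgroup P := ⨅ i ∈ S, (C.coord i).ker

theorem mem_kerOn {S : Set ℤ} {x : P} : x ∈ C.kerOn S ↔ ∀ i ∈ S, C.coord i x = 1 := by
  simp [kerOn, Subgroup.mem_iInf, MonoidHom.mem_ker]

instance (S : Set ℤ) : (C.kerOn S).Normal :=
  Subgroup.normal_iInf_normal fun _ => Subgroup.normal_iInf_normal fun _ => inferInstance

theorem isClosed_setOf_coord_eq (i : ℤ) (q : P ⧸ C.window) : IsClosed {x | C.coord i x = q} :=
  (isClosed_discrete {q}).preimage (C.continuous_coord i)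

theorem isOpen_setOf_coord_eq (i : ℤ) (q : P ⧸ C.window) : IsOpen {x | C.coord i x = q} :=
  (isOpen_discrete {q}).preimage (C.continuous_coord i)

theorem isClosed_kerOn (S : Set ℤ) : IsClosed (C.kerOn S : Set P) := by
  have : (C.kerOn S : Set P) = ⋂ i ∈ S, {x | C.coord i x = 1} := by
    ext x
    simp [mem_kerOn]
  rw [this]
  exact isClosed_biInter fun i _ => C.isClosed_setOf_coord_eq i 1

theorem isOpen_kerOn {S : Set ℤ} (hS : S.Finite) : IsOpen (C.kerOn S : Set P) := by
  have : (C.kerOn S : Set P) = ⋂ i ∈ S, {x | C.coord i x = 1} := by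
    ext x
    simp [mem_kerOn]
  rw [this]
  exact hS.isOpen_biInter fun i _ => C.isOpen_setOf_coord_eq i 1

theorem kerOn_anti {S T : Set ℤ} (h : S ⊆ T) : C.kerOn T ≤ C.kerOn S := fun _ hx =>
  C.mem_kerOn.2 fun i hi => C.mem_kerOn.1 hx i (h hi)

theorem eq_one_of_mem_kerOn {S T : Set ℤ} (h : S ∪ T = Set.univ) {x : P} (hS : x ∈ C.kerOn S)
    (hT : x ∈ C.kerOn T) : x = 1 :=
  C.eq_one_of_coord fun i => (h ▸ Set.mem_univ i : i ∈ S ∪ T).elim (C.mem_kerOn.1 hS i)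
    (C.mem_kerOn.1 hT i)

theorem autPow_mem_kerOn {S : Set ℤ} {k : ℤ} {x : P} :
    P.autPow k x ∈ C.kerOn S ↔ x ∈ C.kerOn ((· + k) '' S) := by
  simp only [mem_kerOn, coord_autPow, Set.forall_mem_image]

theorem relIndex_kerOn_ne_zero {S : Set ℤ} (hS : S.Finite) (H : Subgroup P) :
    (C.kerOn S).relIndex H ≠ 0 := by
  have : Finite (P ⧸ C.kerOn S) := Subgroup.quotient_finite_of_isOpen _ (C.isOpen_kerOn hS)
  have : (C.kerOn S).FiniteIndex := Subgroup.finiteIndex_of_finite_quotient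
  exact Subgroup.FiniteIndex.index_ne_zero

/-- A finite set of coordinates cuts out an open subgroup. To get finite index it therefore suffices
to treat elements that are trivial on a finite window. -/
theorem relIndex_ne_zero_of_le {S : Set ℤ} (hS : S.Finite) {H T : Subgroup P}
    (h : H ⊓ C.kerOn S ≤ T) : T.relIndex H ≠ 0 := by
  intro h0
  apply C.relIndex_kerOn_ne_zero hS H
  rw [← Subgroup.inf_relIndex_left]
  exact Subgroup.relIndex_eq_zero_of_le_left h h0

/-- The elements whose coordinates are trivial far on the right. -/
def right : Subgroup P where
  carrier := {x | ∃ b, x ∈ C.kerOn (Set.Ici b)}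
  one_mem' := ⟨0, Subgroup.one_mem _⟩
  mul_mem' := by
    rintro x y ⟨a, ha⟩ ⟨b, hb⟩
    exact ⟨max a b, Subgroup.mul_mem _
      (C.kerOn_anti (Set.Ici_subset_Ici.2 (le_max_left _ _)) ha)
      (C.kerOn_anti (Set.Ici_subset_Ici.2 (le_max_right _ _)) hb)⟩
  inv_mem' := by
    rintro x ⟨a, ha⟩
    exact ⟨a, Subgroup.inv_mem _ ha⟩

/-- The elements whose coordinates are trivial far on the left. -/
def left : Subgroup P where
  carrier := {x | ∃ b, x ∈ C.kerOn (Set.Iio b)}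
  one_mem' := ⟨0, Subgroup.one_mem _⟩
  mul_mem' := by
    rintro x y ⟨a, ha⟩ ⟨b, hb⟩
    exact ⟨min a b, Subgroup.mul_mem _
      (C.kerOn_anti (Set.Iio_subset_Iio (min_le_left _ _)) ha)
      (C.kerOn_anti (Set.Iio_subset_Iio (min_le_right _ _)) hb)⟩
  inv_mem' := by
    rintro x ⟨a, ha⟩
    exact ⟨a, Subgroup.inv_mem _ ha⟩

instance : C.right.Normal where
  conj_mem := by
    rintro x ⟨b, hb⟩ g
    exact ⟨b, Subgroup.Normal.conj_mem inferInstance x hb g⟩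

instance : C.left.Normal where
  conj_mem := by
    rintro x ⟨b, hb⟩ g
    exact ⟨b, Subgroup.Normal.conj_mem inferInstance x hb g⟩

theorem autPow_mem_right {x : P} (k : ℤ) (hx : x ∈ C.right) : P.autPow k x ∈ C.right := by
  obtain ⟨b, hb⟩ := hx
  refine ⟨b - k, ?_⟩
  rw [autPow_mem_kerOn]
  simpa using hb

theorem autPow_mem_left {x : P} (k : ℤ) (hx : x ∈ C.left) : P.autPow k x ∈ C.left := by
  obtain ⟨b, hb⟩ := hx
  refine ⟨b - k, ?_⟩
  rw [autPow_mem_kerOn]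
  simpa using hb

/-- The homoclinic group: the elements with finitely many nontrivial coordinates. -/
def homoclinic : Subgroup P := C.left ⊓ C.right

instance : C.homoclinic.Normal := Subgroup.normal_inf_normal _ _

/-- The closure of the group of homoclinic elements of a stable subgroup. -/
def core (H : P.StableSubgroup) : P.StableSubgroup :=
  .closure (H.toSubgroup ⊓ C.homoclinic) fun k x hx =>
    ⟨(H.autPow_mem_iff k x).2 hx.1, C.autPow_mem_left k hx.2.1, C.autPow_mem_right k hx.2.2⟩

theorem inf_homoclinic_le_core (H : P.StableSubgroup) :
    H.toSubgroup ⊓ C.homoclinic ≤ (C.core H).toSubgroup :=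
  Subgroup.le_topologicalClosure _

theorem core_le (H : P.StableSubgroup) : (C.core H).toSubgroup ≤ H.toSubgroup :=
  Subgroup.topologicalClosure_minimal _ inf_le_left H.isClosed

theorem core_le_of_inf_le {H K : P.StableSubgroup}
    (h : H.toSubgroup ⊓ C.homoclinic ≤ K.toSubgroup) :
    (C.core H).toSubgroup ≤ (C.core K).toSubgroup :=
  Subgroup.topologicalClosure_minimal _
    ((le_inf h inf_le_right).trans (C.inf_homoclinic_le_core K)) (C.core K).isClosed

theorem core_mono {H K : P.StableSubgroup} (h : H.toSubgroup ≤ K.toSubgroup) :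
    (C.core H).toSubgroup ≤ (C.core K).toSubgroup :=
  C.core_le_of_inf_le (inf_le_left.trans h)

theorem core_le_core_core (H : P.StableSubgroup) :
    (C.core H).toSubgroup ≤ (C.core (C.core H)).toSubgroup :=
  C.core_le_of_inf_le (C.inf_homoclinic_le_core H)

/-- The closed subgroups on growing windows decrease to the trivial group, so compactness puts one
of them inside `U`. -/
theorem nhds_one_basis {U : Set P} (hU : U ∈ nhds (1 : P)) :
    ∃ n : ℕ, (C.kerOn (Set.Icc (-n : ℤ) n) : Set P) ⊆ U := by
  refine exists_subset_nhds_of_isCompact'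
    (V := fun n : ℕ => (C.kerOn (Set.Icc (-n : ℤ) n) : Set P)) ?_
    (fun n => (C.isClosed_kerOn _).isCompact) (fun n => C.isClosed_kerOn _) ?_
  · refine directed_of_isDirected_le fun m n h => ?_
    refine C.kerOn_anti (Set.Icc_subset_Icc ?_ ?_) <;> omega
  · intro x hx
    rw [Set.mem_iInter] at hx
    rw [C.eq_one_of_coord (x := x) fun i => C.mem_kerOn.1 (hx i.natAbs) i (by
      simp only [Set.mem_Icc]; omega)]
    exact hU

theorem tendsto_autPow_of_mem_right {x : P} (hx : x ∈ C.right) :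
    Filter.Tendsto (fun n : ℕ => P.autPow n x) Filter.atTop (nhds 1) := by
  intro U hU
  obtain ⟨n, hn⟩ := C.nhds_one_basis hU
  obtain ⟨b, hb⟩ := hx
  rw [Filter.mem_map]
  filter_upwards [Filter.eventually_ge_atTop (n + b.natAbs)] with m hm
  refine hn (C.autPow_mem_kerOn.2 (C.kerOn_anti ?_ hb))
  rintro _ ⟨i, hi, rfl⟩
  simp only [Set.mem_Icc, Set.mem_Ici] at hi ⊢
  omega

theorem tendsto_autPow_neg_of_mem_left {x : P} (hx : x ∈ C.left) :
    Filter.Tendsto (fun n : ℕ => P.autPow (-n) x) Filter.atTop (nhds 1) := by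
  intro U hU
  obtain ⟨n, hn⟩ := C.nhds_one_basis hU
  obtain ⟨b, hb⟩ := hx
  rw [Filter.mem_map]
  filter_upwards [Filter.eventually_ge_atTop (n + b.natAbs + 1)] with m hm
  refine hn (C.autPow_mem_kerOn.2 (C.kerOn_anti ?_ hb))
  rintro _ ⟨i, hi, rfl⟩
  simp only [Set.mem_Icc, Set.mem_Iio] at hi ⊢
  omega

/-! ### Leading symbols and finite index -/

/-- The group of the values at `0` of the elements of `H` whose coordinates with negative index
are trivial. -/
def leading (H : Subgroup P) : Subgroup (P ⧸ C.window) :=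
  (H ⊓ C.kerOn (Set.Iio 0)).map (C.coord 0)

theorem mem_leading {H : Subgroup P} {q : P ⧸ C.window} :
    q ∈ C.leading H ↔ ∃ x ∈ H, x ∈ C.kerOn (Set.Iio 0) ∧ C.coord 0 x = q := by
  simp [leading, Subgroup.mem_map, and_assoc]

theorem leading_mono {H K : Subgroup P} (h : H ≤ K) : C.leading H ≤ C.leading K :=
  Subgroup.map_mono (inf_le_inf_right _ h)

theorem exists_of_mem_leading {H : P.StableSubgroup} {q : P ⧸ C.window}
    (hq : q ∈ C.leading H.toSubgroup) (n : ℤ) :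
    ∃ x ∈ H.toSubgroup, x ∈ C.kerOn (Set.Iio n) ∧ C.coord n x = q := by
  obtain ⟨x, hx, hx0, rfl⟩ := C.mem_leading.1 hq
  refine ⟨P.autPow (-n) x, (H.autPow_mem_iff _ x).2 hx, ?_, ?_⟩
  · rw [autPow_mem_kerOn]
    refine C.kerOn_anti ?_ hx0
    rintro _ ⟨i, hi, rfl⟩
    simp only [Set.mem_Iio] at hi ⊢
    omega
  · rw [coord_autPow, add_neg_cancel]

/-- Compactness: witnesses trivial on ever longer words before `0` accumulate at one that is trivial
on the whole negative half-line. -/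
theorem mem_leading_of_forall (H : P.StableSubgroup) (q : P ⧸ C.window)
    (h : ∀ n : ℕ, ∃ x ∈ H.toSubgroup, x ∈ C.kerOn (Set.Ico (-n : ℤ) 0) ∧ C.coord 0 x = q) :
    q ∈ C.leading H.toSubgroup := by
  obtain ⟨x, hx⟩ := IsCompact.nonempty_iInter_of_sequence_nonempty_isCompact_isClosed
    (fun n : ℕ => (H.toSubgroup : Set P) ∩ ((C.kerOn (Set.Ico (-n : ℤ) 0) : Set P) ∩
      {x | C.coord 0 x = q}))
    (fun n x hx => ⟨hx.1, C.kerOn_anti (Set.Ico_subset_Ico (by push_cast; omega) le_rfl) hx.2.1,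
      hx.2.2⟩)
    (fun n => by
      obtain ⟨x, h1, h2, h3⟩ := h n
      exact ⟨x, h1, h2, h3⟩)
    (H.isClosed.inter ((C.isClosed_kerOn _).inter (C.isClosed_setOf_coord_eq 0 q))).isCompact
    (fun n => H.isClosed.inter ((C.isClosed_kerOn _).inter (C.isClosed_setOf_coord_eq 0 q)))
  rw [Set.mem_iInter] at hx
  refine C.mem_leading.2 ⟨x, (hx 0).1, C.mem_kerOn.2 fun i hi => ?_, (hx 0).2.2⟩
  exact C.mem_kerOn.1 (hx i.natAbs).2.1 i (by simp only [Set.mem_Iio, Set.mem_Ico] at hi ⊢; omega)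

/-- Symbols following a sufficiently long trivial word are leading symbols. -/
theorem exists_forall_mem_leading (H : P.StableSubgroup) :
    ∃ n₀ : ℕ, ∀ n : ℕ, n₀ ≤ n → ∀ x ∈ H.toSubgroup, x ∈ C.kerOn (Set.Ico (0 : ℤ) n) →
      C.coord n x ∈ C.leading H.toSubgroup := by
  -- Each symbol that is not leading is excluded by some finite length of trivial past. There are
  -- finitely many symbols, so one length serves them all.
  have key : ∀ q : P ⧸ C.window, ∃ n₀ : ℕ, q ∉ C.leading H.toSubgroup →
      ∀ x ∈ H.toSubgroup, x ∈ C.kerOn (Set.Ico (-n₀ : ℤ) 0) → C.coord 0 x ≠ q := by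
    intro q
    by_contra! hcon
    exact (hcon 0).1 (C.mem_leading_of_forall H q fun n => (hcon n).2)
  choose f hf using key
  obtain ⟨n₀, hn₀⟩ := (Set.finite_range f).bddAbove
  refine ⟨n₀, fun n hn x hx hx0 => ?_⟩
  by_contra hq
  refine hf _ hq (P.autPow n x) ((H.autPow_mem_iff _ x).2 hx) ?_ (by rw [coord_autPow, zero_add])
  rw [autPow_mem_kerOn]
  refine C.kerOn_anti ?_ hx0
  have : f (C.coord n x) ≤ n₀ := hn₀ ⟨_, rfl⟩
  rintro _ ⟨i, hi, rfl⟩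
  simp only [Set.mem_Ico] at hi ⊢
  omega

/-- If `T ≤ H` have the same leading symbols, then an element of `H` that is trivial on a long
window agrees on the right with an element of `T` that is trivial on the left. -/
theorem exists_eq_on_right {T H : P.StableSubgroup} (hTH : T.toSubgroup ≤ H.toSubgroup)
    (hlead : C.leading H.toSubgroup ≤ C.leading T.toSubgroup) :
    ∃ n₀ : ℕ, ∀ x ∈ H.toSubgroup, x ∈ C.kerOn (Set.Ico (0 : ℤ) n₀) →
      ∃ t ∈ T.toSubgroup, t ∈ C.kerOn (Set.Iio (n₀ : ℤ)) ∧ t⁻¹ * x ∈ C.kerOn (Set.Ici 0) := by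
  obtain ⟨n₀, hn₀⟩ := C.exists_forall_mem_leading H
  refine ⟨n₀, fun x hx hx0 => ?_⟩
  -- Correct one symbol at a time: the first symbol where `t` and `x` may differ follows a long
  -- trivial word of `t⁻¹ * x`, so it is leading for `H`, hence for `T`, and is removed by an
  -- element of `T` that starts there.
  have approx : ∀ k : ℕ, ∃ t ∈ T.toSubgroup, t ∈ C.kerOn (Set.Iio (n₀ : ℤ)) ∧
      t⁻¹ * x ∈ C.kerOn (Set.Ico (0 : ℤ) (n₀ + k : ℕ)) := by
    intro k
    induction k with
    | zero => exact ⟨1, one_mem _, one_mem _, by simpa using hx0⟩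
    | succ k ih =>
      obtain ⟨t, ht, ht1, ht2⟩ := ih
      have h1 := hlead (hn₀ (n₀ + k) (by omega) (t⁻¹ * x)
        (mul_mem (inv_mem (hTH ht)) hx) ht2)
      obtain ⟨s, hs, hs1, hs2⟩ := C.exists_of_mem_leading h1 (n₀ + k : ℕ)
      refine ⟨t * s, mul_mem ht hs, mul_mem ht1 (C.kerOn_anti
        (Set.Iio_subset_Iio (by push_cast; omega)) hs1), C.mem_kerOn.2 fun i hi => ?_⟩
      rw [mul_inv_rev, mul_assoc, map_mul, map_inv, inv_mul_eq_one]
      simp only [Set.mem_Ico] at hi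
      rcases lt_or_eq_of_le (show i ≤ (n₀ + k : ℕ) by push_cast at hi ⊢; omega) with h | h
      · rw [C.mem_kerOn.1 hs1 i h, C.mem_kerOn.1 ht2 i ⟨hi.1, h⟩]
      · rw [h, hs2]
  have hcl : ∀ S, IsClosed {t : P | t⁻¹ * x ∈ C.kerOn S} := fun S =>
    (C.isClosed_kerOn S).preimage (by fun_prop)
  obtain ⟨t, ht⟩ := IsCompact.nonempty_iInter_of_sequence_nonempty_isCompact_isClosed
    (fun k : ℕ => (T.toSubgroup : Set P) ∩ ((C.kerOn (Set.Iio (n₀ : ℤ)) : Set P) ∩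
      {t | t⁻¹ * x ∈ C.kerOn (Set.Ico (0 : ℤ) (n₀ + k : ℕ))}))
    (fun k x hx => ⟨hx.1, hx.2.1,
      C.kerOn_anti (Set.Ico_subset_Ico le_rfl (by push_cast; omega)) hx.2.2⟩)
    (fun k => by
      obtain ⟨x, h1, h2, h3⟩ := approx k
      exact ⟨x, h1, h2, h3⟩)
    (T.isClosed.inter ((C.isClosed_kerOn _).inter (hcl _))).isCompact
    (fun k => T.isClosed.inter ((C.isClosed_kerOn _).inter (hcl _)))
  rw [Set.mem_iInter] at ht
  refine ⟨t, (ht 0).1, (ht 0).2.1, C.mem_kerOn.2 fun i hi => ?_⟩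
  exact C.mem_kerOn.1 (ht (i.natAbs + 1)).2.2 i (by
    simp only [Set.mem_Ici, Set.mem_Ico] at hi ⊢; omega)

/-- A stable subgroup with the same leading symbols has finite index. -/
theorem relIndex_ne_zero_of_leading_le {T H : P.StableSubgroup} (hTH : T.toSubgroup ≤ H.toSubgroup)
    (hlead : C.leading H.toSubgroup ≤ C.leading T.toSubgroup) :
    T.toSubgroup.relIndex H.toSubgroup ≠ 0 := by
  obtain ⟨n₀, hn₀⟩ := C.exists_eq_on_right hTH hlead
  -- The elements of `H` that agree with some element of `T` on `[0, ∞)`. This group has finite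
  -- index in `H` and is mapped into itself by positive powers, hence onto itself. So its elements
  -- agree with elements of `T` on `[-n, ∞)` for every `n`, and lie in the closed group `T`.
  set S : Subgroup P := H.toSubgroup ⊓ (T.toSubgroup ⊔ C.kerOn (Set.Ici 0))
  have hle : H.toSubgroup ⊓ C.kerOn (Set.Ico (0 : ℤ) n₀) ≤ S := by
    rintro x ⟨hx, hx0⟩
    obtain ⟨t, ht, -, ht1⟩ := hn₀ x hx hx0
    exact ⟨hx, Subgroup.mem_sup_of_normal_right.2 ⟨t, ht, _, ht1, mul_inv_cancel_left t x⟩⟩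
  have hfin := C.relIndex_ne_zero_of_le (Set.finite_Ico _ _) hle
  have hmap : ∀ n : ℕ, S.map (P.autPow n).toMonoidHom ≤ S := by
    rintro n _ ⟨x, ⟨hx, hx'⟩, rfl⟩
    obtain ⟨t, ht, e, he, rfl⟩ := Subgroup.mem_sup_of_normal_right.1 hx'
    refine ⟨(H.autPow_mem_iff n _).2 hx, ?_⟩
    change P.autPow n (t * e) ∈ _
    rw [map_mul]
    refine Subgroup.mem_sup_of_normal_right.2 ⟨_, (T.autPow_mem_iff n _).2 ht, _, ?_, rfl⟩
    refine C.autPow_mem_kerOn.2 (C.kerOn_anti ?_ he)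
    rintro _ ⟨i, hi, rfl⟩
    simp only [Set.mem_Ici] at hi ⊢
    omega
  have hST : S ≤ T.toSubgroup := by
    intro x hx
    have happ : ∀ n : ℕ, ∃ t ∈ T.toSubgroup, t⁻¹ * x ∈ C.kerOn (Set.Ici (-n : ℤ)) := by
      intro n
      rw [← map_autPow_eq_of_le (S := S) inf_le_left hfin (hmap n)] at hx
      obtain ⟨y, ⟨hy, hy'⟩, rfl⟩ := hx
      obtain ⟨t, ht, e, he, rfl⟩ := Subgroup.mem_sup_of_normal_right.1 hy'
      refine ⟨P.autPow n t, (T.autPow_mem_iff n _).2 ht, ?_⟩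
      change (P.autPow n t)⁻¹ * P.autPow n (t * e) ∈ _
      rw [map_mul, inv_mul_cancel_left]
      refine C.autPow_mem_kerOn.2 (C.kerOn_anti ?_ he)
      rintro _ ⟨i, hi, rfl⟩
      simp only [Set.mem_Ici] at hi ⊢
      omega
    have hx' : x ∈ closure (T.toSubgroup : Set P) := by
      rw [mem_closure_iff_nhds]
      intro U hU
      have hU' : (fun y : P => x * y⁻¹) ⁻¹' U ∈ nhds (1 : P) := by
        apply (Continuous.continuousAt (by fun_prop)).preimage_mem_nhds
        simpa using hU
      obtain ⟨n, hn⟩ := C.nhds_one_basis hU'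
      obtain ⟨t, ht, ht'⟩ := happ n
      have := hn (C.kerOn_anti Set.Icc_subset_Ici_self ht')
      simp only [Set.mem_preimage, mul_inv_rev, inv_inv, mul_inv_cancel_left] at this
      exact ⟨t, this, ht⟩
    rwa [T.isClosed.closure_eq] at hx'
  exact C.relIndex_ne_zero_of_le (Set.finite_Ico _ _) (hle.trans hST)

/-- The homoclinic elements of a stable subgroup have all leading symbols. -/
theorem leading_le_leading_core (H : P.StableSubgroup) :
    C.leading H.toSubgroup ≤ C.leading (C.core H).toSubgroup := by
  obtain ⟨n₀, hn₀⟩ := C.exists_eq_on_right (T := H) le_rfl le_rfl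
  -- The elements of `H` that agree on the negative half-line with an element of `H` that is trivial
  -- far on the right. The power `-1` moves sequences to the right, so it maps `S` into itself and
  -- improves the agreement to all indices below `1`.
  set S : Subgroup P := H.toSubgroup ⊓ ((H.toSubgroup ⊓ C.right) ⊔ C.kerOn (Set.Iio 0))
  have hfin : S.relIndex H.toSubgroup ≠ 0 := by
    refine C.relIndex_ne_zero_of_le (Set.finite_Ico 0 (n₀ : ℤ)) ?_
    rintro x ⟨hx, hx0⟩
    obtain ⟨t, ht, ht0, ht1⟩ := hn₀ x hx hx0
    refine ⟨hx, Subgroup.mem_sup_of_normal_right.2 ⟨x * t⁻¹, ⟨H.toSubgroup.mul_mem hx (H.toSubgroup.inv_mem ht), 0, ?_⟩, t,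
      C.kerOn_anti (Set.Iio_subset_Iio (by omega)) ht0, inv_mul_cancel_right x t⟩⟩
    have := Subgroup.Normal.conj_mem inferInstance _ ht1 t
    rwa [mul_inv_cancel_left] at this
  have hshift : ∀ x, x ∈ S → P.autPow (-1) x ∈ H.toSubgroup ⊓
      ((H.toSubgroup ⊓ C.right) ⊔ C.kerOn (Set.Iio 1)) := by
    rintro x ⟨hx, hx'⟩
    obtain ⟨d, hd, a, ha, rfl⟩ := Subgroup.mem_sup_of_normal_right.1 hx'
    refine ⟨(H.autPow_mem_iff _ _).2 hx, ?_⟩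
    rw [map_mul]
    refine Subgroup.mem_sup_of_normal_right.2 ⟨_, ⟨(H.autPow_mem_iff _ _).2 hd.1,
      C.autPow_mem_right _ hd.2⟩, _, C.autPow_mem_kerOn.2 (C.kerOn_anti ?_ ha), rfl⟩
    rintro _ ⟨i, hi, rfl⟩
    simp only [Set.mem_Iio] at hi ⊢
    omega
  have hmap : S.map (P.autPow (-1)).toMonoidHom ≤ S := by
    rintro _ ⟨x, hx, rfl⟩
    refine inf_le_inf_left _ (sup_le_sup_left (C.kerOn_anti (Set.Iio_subset_Iio ?_)) _)
      (hshift x hx)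
    norm_num
  rintro _ ⟨x, ⟨hx, hx0⟩, rfl⟩
  -- An element trivial on the negative half-line agrees there with `1`. Writing it as the image of
  -- some `y ∈ S` gains the coordinate `0`: the resulting `d` is trivial on both far sides and has
  -- the same symbol at `0`.
  have hxS : x ∈ S := ⟨hx, le_sup_right (a := H.toSubgroup ⊓ C.right) hx0⟩
  rw [← map_autPow_eq_of_le (S := S) inf_le_left hfin hmap] at hxS
  obtain ⟨y, hy, rfl⟩ := hxS
  change P.autPow (-1) y ∈ _ at hx
  change P.autPow (-1) y ∈ _ at hx0
  change C.coord 0 (P.autPow (-1) y) ∈ _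
  obtain ⟨d, hd, a, ha, h⟩ := Subgroup.mem_sup_of_normal_right.1 (hshift y hy).2
  rw [← h] at hx0 ⊢
  have hd0 : d ∈ C.kerOn (Set.Iio 0) := (Subgroup.mul_mem_cancel_right _
    (C.kerOn_anti (Set.Iio_subset_Iio zero_le_one) ha)).1 hx0
  rw [map_mul, C.mem_kerOn.1 ha 0 (by simp), mul_one]
  exact C.mem_leading.2 ⟨d, C.inf_homoclinic_le_core H ⟨hd.1, ⟨0, hd0⟩, hd.2⟩, hd0, rfl⟩

theorem core_relIndex_ne_zero (H : P.StableSubgroup) :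
    (C.core H).toSubgroup.relIndex H.toSubgroup ≠ 0 :=
  C.relIndex_ne_zero_of_leading_le (C.core_le H) (C.leading_le_leading_core H)

end Coding

end CompactPair

/-! ### Transitive subgroups are those with dense homoclinic elements -/

namespace CompactPair

namespace Coding

variable {P : CompactPair.{u}} (C : P.Coding)

theorem core_eq_of_transitive {H : P.StableSubgroup}
    (h : (P.restrict H).IsTopologicallyTransitive) : C.core H = H :=
  h.eq_of_relIndex_ne_zero (C.core_le H) (C.core_relIndex_ne_zero H)

theorem secondCountableTopology (C : P.Coding) : SecondCountableTopology P :=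
  ((continuous_pi fun i => C.continuous_coord i).isClosedEmbedding
    C.coord_injective).isEmbedding.secondCountableTopology

theorem dense_homoclinic {H : P.StableSubgroup} (h : H.toSubgroup ≤ (C.core H).toSubgroup) :
    Dense {x : P.restrict H | incl H x ∈ C.homoclinic} := by
  intro x
  refine closure_subtype.2 (closure_mono ?_ (h (incl_mem H x)))
  rintro y ⟨hy, hy'⟩
  exact ⟨⟨y, hy⟩, hy', rfl⟩

theorem tendsto_autPow_restrict {H : P.StableSubgroup} {f : ℕ → ℤ} {x : P.restrict H}
    (h : Filter.Tendsto (fun n => P.autPow (f n) (incl H x)) Filter.atTop (nhds 1)) :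
    Filter.Tendsto (fun n => (P.restrict H).autPow (f n) x) Filter.atTop (nhds 1) := by
  refine tendsto_subtype_rng.2 ?_
  exact h.congr fun n => (coe_autPow_restrict H _ x).symm

/-- A stable subgroup in which the homoclinic elements are dense is topologically transitive. -/
theorem transitive_of_le_core {H : P.StableSubgroup}
    (h : H.toSubgroup ≤ (C.core H).toSubgroup) :
    (P.restrict H).IsTopologicallyTransitive := by
  have hd := C.dense_homoclinic h
  have : SecondCountableTopology P := C.secondCountableTopology
  have : SecondCountableTopology (P.restrict H) :=
    Topology.IsEmbedding.subtypeVal.secondCountableTopology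
  set B := TopologicalSpace.countableBasis (P.restrict H)
  have hBb := TopologicalSpace.isBasis_countableBasis (P.restrict H)
  -- For homoclinic `v` near one point and `w` near another, `v * α^(-n) w` tends to `v`, while its
  -- image `α^n v * w` tends to `w`. Hence the translates of every basic open set have dense union,
  -- and Baire's theorem gives a point with dense orbit.
  have hdense : ∀ U : B, Dense (⋃ n : ℕ, (P.restrict H).autPow n ⁻¹' (U : Set (P.restrict H))) := by
    intro U
    rw [dense_iff_inter_open]
    intro V hV hVne
    obtain ⟨v, hvV, hv⟩ := hd.inter_open_nonempty V hV hVne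
    obtain ⟨w, hwU, hw⟩ := hd.inter_open_nonempty U (hBb.isOpen U.2)
      (TopologicalSpace.nonempty_of_mem_countableBasis U.2)
    have h1 := (tendsto_autPow_restrict (C.tendsto_autPow_neg_of_mem_left hw.1)).const_mul v
    have h2 := (tendsto_autPow_restrict (C.tendsto_autPow_of_mem_right hv.2)).mul_const w
    rw [mul_one] at h1
    rw [one_mul] at h2
    obtain ⟨n, hn1, hn2⟩ := ((h1.eventually_mem (hV.mem_nhds hvV)).and
      (h2.eventually_mem ((hBb.isOpen U.2).mem_nhds hwU))).exists
    refine ⟨_, hn1, Set.mem_iUnion.2 ⟨n, ?_⟩⟩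
    rw [Set.mem_preimage, map_mul, autPow_autPow, add_neg_cancel, autPow_zero]
    exact hn2
  have : Countable B := TopologicalSpace.countable_countableBasis _
  obtain ⟨x, hx⟩ := (dense_iInter_of_isOpen (fun U : B => isOpen_iUnion fun n : ℕ =>
    (hBb.isOpen U.2).preimage (continuous_autPow _)) hdense).nonempty
  refine ⟨x, hBb.dense_iff.2 fun U hU _ => ?_⟩
  obtain ⟨n, hn⟩ := Set.mem_iUnion.1 (Set.mem_iInter.1 hx ⟨U, hU⟩)
  exact ⟨_, hn, n, rfl⟩

theorem transitive_core (H : P.StableSubgroup) :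
    (P.restrict (C.core H)).IsTopologicallyTransitive :=
  C.transitive_of_le_core (C.core_le_core_core H)

theorem transitive_join (C : P.Coding) {A B : P.StableSubgroup}
    (hA : (P.restrict A).IsTopologicallyTransitive)
    (hB : (P.restrict B).IsTopologicallyTransitive) :
    (P.restrict (A.join B)).IsTopologicallyTransitive := by
  apply C.transitive_of_le_core
  refine Subgroup.topologicalClosure_minimal _ (sup_le ?_ ?_) (C.core _).isClosed
  · refine (congrArg _ (C.core_eq_of_transitive hA)).symm.le.trans (C.core_mono ?_)
    exact le_sup_left.trans (Subgroup.le_topologicalClosure _)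
  · refine (congrArg _ (C.core_eq_of_transitive hB)).symm.le.trans (C.core_mono ?_)
    exact le_sup_right.trans (Subgroup.le_topologicalClosure _)

theorem transitive_bot (C : P.Coding) : (P.restrict (.bot P)).IsTopologicallyTransitive :=
  C.transitive_of_le_core bot_le

/-- This makes the number of leading symbols a rank function on transitive subgroups. It is bounded
by the size of the alphabet and replaces both chain conditions. -/
theorem card_leading_lt {A B : P.StableSubgroup} (hAB : A.toSubgroup ≤ B.toSubgroup)
    (hB : (P.restrict B).IsTopologicallyTransitive) (hne : A ≠ B) :
    Nat.card (C.leading A.toSubgroup) < Nat.card (C.leading B.toSubgroup) := by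
  by_contra! hcard
  have h := Subgroup.eq_of_le_of_card_ge (C.leading_mono hAB) hcard
  exact hne (hB.eq_of_relIndex_ne_zero hAB (C.relIndex_ne_zero_of_leading_le hAB h.ge))

theorem card_leading_le (H : Subgroup P) :
    Nat.card (C.leading H) ≤ Nat.card (P ⧸ C.window) :=
  Subgroup.card_le_card_group _

end Coding

/-- A pair of finite depth has a coding. -/
theorem HasFiniteDepth.nonempty_coding {P : CompactPair.{u}} (h : P.HasFiniteDepth) :
    Nonempty P.Coding := by
  obtain ⟨V, hV, hbot⟩ := h
  have : Finite (P ⧸ V) := Subgroup.quotient_finite_of_isOpen V hV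
  have : V.FiniteIndex := Subgroup.finiteIndex_of_finite_quotient
  -- An open subgroup of a compact group has finite index, so its normal core is closed of finite
  -- index, hence open.
  refine ⟨⟨V.normalCore, inferInstance, ?_, fun x hx => ?_⟩⟩
  · exact Subgroup.isOpen_of_isClosed_of_finiteIndex _
      (V.normalCore_isClosed (Subgroup.isClosed_of_isOpen V hV))
  · rw [← Subgroup.mem_bot, ← hbot, Subgroup.mem_iInf]
    intro k
    refine ⟨P.autPow (-k) x, V.normalCore_le (hx (-k)), ?_⟩
    change P.autPow k (P.autPow (-k) x) = x
    rw [autPow_autPow, add_neg_cancel, autPow_zero]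

end CompactPair

/-! ### Finite covers, co-commensurability, maximal transitive subgroups -/

namespace CompactPair

variable {P Q R : CompactPair.{u}}

theorem finite_map_iff_relIndex_ker_ne_zero {G G' : Type*} [Group G] [Group G'] (f : G →* G')
    (K : Subgroup G) : Finite (K.map f) ↔ f.ker.relIndex K ≠ 0 := by
  rw [Subgroup.relIndex_ker]
  exact ⟨fun _ => Nat.card_pos.ne', Nat.finite_of_card_ne_zero⟩

theorem finite_comap_of_finite_ker {G G' : Type*} [Group G] [Group G'] (f : G →* G')
    [Finite f.ker] (K : Subgroup G') [hK : Finite K] : Finite (K.comap f) := by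
  refine Set.Finite.to_subtype (Set.Finite.preimage' (s := (K : Set G')) (f := f)
    (Set.toFinite _) fun b _ => ?_)
  rcases (f ⁻¹' {b}).eq_empty_or_nonempty with h | ⟨x, rfl⟩
  · rw [h]
    exact Set.finite_empty
  · refine ((Set.toFinite (f.ker : Set G)).image (x * ·)).subset fun y hy => ?_
    exact ⟨x⁻¹ * y, by simp [MonoidHom.mem_ker, show f y = f x from hy], mul_inv_cancel_left x y⟩

/-- A continuous equivariant surjective homomorphism with finite kernel. -/
def IsFiniteCover (φ : P →ₜ* Q) : Prop :=
  Function.Surjective φ ∧ Finite φ.toMonoidHom.ker ∧ ∀ x, φ (P.aut x) = Q.aut (φ x)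

theorem IsFiniteCover.comp {ψ : Q →ₜ* R} {φ : P →ₜ* Q} (hψ : IsFiniteCover ψ)
    (hφ : IsFiniteCover φ) : IsFiniteCover (ψ.comp φ) := by
  refine ⟨hψ.1.comp hφ.1, ?_, fun x => ?_⟩
  · have := hψ.2.1
    have := hφ.2.1
    exact finite_comap_of_finite_ker φ.toMonoidHom ψ.toMonoidHom.ker
  · exact (congrArg ψ (hφ.2.2 x)).trans (hψ.2.2 _)

theorem IsFiniteCover.id (P : CompactPair.{u}) : IsFiniteCover (ContinuousMonoidHom.id P) := by
  refine ⟨Function.surjective_id, ?_, fun _ => rfl⟩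
  have : (ContinuousMonoidHom.id P).toMonoidHom.ker = ⊥ := MonoidHom.ker_id
  rw [this]
  infer_instance

/-- A transitive finite cover of an irreducible pair is irreducible. -/
theorem IsIrreducible.of_isFiniteCover (hQ : Q.IsIrreducible)
    (hP : P.IsTopologicallyTransitive) {φ : P →ₜ* Q} (hφ : IsFiniteCover φ) :
    P.IsIrreducible := by
  have := hφ.2.1
  have := hQ.1
  refine ⟨Infinite.of_surjective φ hφ.1, fun N hN hne => ?_⟩
  -- If `N` maps onto `Q`, then `N` and the finite kernel generate `P`, so `N` has finite index and
  -- transitivity forces `N = P`. Otherwise the image of `N` is finite, and so is `N`.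
  by_cases htop : N.toSubgroup.map φ.toMonoidHom = ⊤
  · refine absurd (hP.eq_top_of_finiteIndex N ⟨?_⟩) hne
    have h := Subgroup.comap_map_eq φ.toMonoidHom N.toSubgroup
    rw [htop, Subgroup.comap_top] at h
    rw [← Subgroup.relIndex_top_right, h, sup_comm, Subgroup.relIndex_sup_right]
    intro h0
    have h1 : (⊥ : Subgroup P).relIndex φ.toMonoidHom.ker = 0 :=
      Subgroup.relIndex_eq_zero_of_le_left bot_le h0
    rw [Subgroup.relIndex_bot_left] at h1
    exact Nat.card_pos.ne' h1
  · have : Finite (N.toSubgroup.map φ.toMonoidHom) :=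
      hQ.2 (N.map φ hφ.2.2) (hN.map φ.toMonoidHom hφ.1) htop
    have := finite_comap_of_finite_ker φ.toMonoidHom (N.toSubgroup.map φ.toMonoidHom)
    exact Finite.Set.subset _ (Subgroup.le_comap_map φ.toMonoidHom N.toSubgroup)

/-- The product of two compact pairs. -/
def prod (P Q : CompactPair.{u}) : CompactPair.{u} where
  carrier := P × Q
  aut :=
    { toFun := fun x => (P.aut x.1, Q.aut x.2)
      invFun := fun x => (P.aut.symm x.1, Q.aut.symm x.2)
      left_inv := fun x => Prod.ext (P.aut.symm_apply_apply x.1) (Q.aut.symm_apply_apply x.2)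
      right_inv := fun x => Prod.ext (P.aut.apply_symm_apply x.1) (Q.aut.apply_symm_apply x.2)
      map_mul' := fun x y => Prod.ext (map_mul P.aut x.1 y.1) (map_mul Q.aut x.2 y.2)
      continuous_toFun := (P.aut.continuous.comp continuous_fst).prodMk
        (Q.aut.continuous.comp continuous_snd)
      continuous_invFun := (P.aut.symm.continuous.comp continuous_fst).prodMk
        (Q.aut.symm.continuous.comp continuous_snd) }

/-- The first projection of a product of compact pairs. -/
def prodFst (P Q : CompactPair.{u}) : P.prod Q →ₜ* P where
  toMonoidHom := MonoidHom.fst P Q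
  continuous_toFun := continuous_fst

/-- The second projection of a product of compact pairs. -/
def prodSnd (P Q : CompactPair.{u}) : P.prod Q →ₜ* Q where
  toMonoidHom := MonoidHom.snd P Q
  continuous_toFun := continuous_snd

/-- The fibre product of two equivariant homomorphisms. -/
def fibreProduct (φ : P →ₜ* R) (ψ : Q →ₜ* R) (hφ : ∀ x, φ (P.aut x) = R.aut (φ x))
    (hψ : ∀ x, ψ (Q.aut x) = R.aut (ψ x)) : (P.prod Q).StableSubgroup :=
  .mk' ((φ.comp (prodFst P Q)).toMonoidHom.eqLocus (ψ.comp (prodSnd P Q)).toMonoidHom)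
    (isClosed_eq (φ.comp (prodFst P Q)).continuous (ψ.comp (prodSnd P Q)).continuous)
    (by
      intro k x hx
      change (φ.comp (prodFst P Q)).toMonoidHom _ = (ψ.comp (prodSnd P Q)).toMonoidHom _
      rw [map_autPow _ (fun x : P.prod Q => hφ x.1), map_autPow _ (fun x : P.prod Q => hψ x.2)]
      exact congrArg _ hx)

theorem CoCommensurable.refl (P : CompactPair.{u}) : CoCommensurable P P :=
  ⟨P, .id P, .id P, IsFiniteCover.id P, IsFiniteCover.id P⟩

theorem CoCommensurable.symm (h : CoCommensurable P Q) : CoCommensurable Q P := by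
  obtain ⟨K, φ, ψ, hφ, hψ⟩ := h
  exact ⟨K, ψ, φ, hψ, hφ⟩

/-- The fibre product of the two covers over the middle pair covers both; the kernel of each
projection embeds in the finite kernel of the opposite cover. -/
theorem CoCommensurable.trans (h : CoCommensurable P Q) (h' : CoCommensurable Q R) :
    CoCommensurable P R := by
  obtain ⟨K, φ₁, φ₂, hφ₁, hφ₂⟩ := h
  obtain ⟨L, ψ₁, ψ₂, hψ₁, hψ₂⟩ := h'
  set F := fibreProduct φ₂ ψ₁ hφ₂.2.2 hψ₁.2.2
  have h1 : IsFiniteCover ((prodFst K L).comp (incl F)) := by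
    refine ⟨fun x => ?_, ?_, fun _ => rfl⟩
    · obtain ⟨y, hy⟩ := hψ₁.1 (φ₂ x)
      exact ⟨⟨(x, y), hy.symm⟩, rfl⟩
    · have := hψ₁.2.1
      refine Finite.of_injective
        (fun z => (⟨z.1.1.2, ?_⟩ : ψ₁.toMonoidHom.ker)) fun z w hzw => ?_
      · have hz : z.1.1.1 = 1 := z.2
        have := z.1.2
        change φ₂ z.1.1.1 = ψ₁ z.1.1.2 at this
        rw [hz, map_one] at this
        exact this.symm
      · have hz : z.1.1.1 = 1 := z.2
        have hw : w.1.1.1 = 1 := w.2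
        exact Subtype.ext (Subtype.ext (Prod.ext (hz.trans hw.symm) (congrArg Subtype.val hzw)))
  have h2 : IsFiniteCover ((prodSnd K L).comp (incl F)) := by
    refine ⟨fun y => ?_, ?_, fun _ => rfl⟩
    · obtain ⟨x, hx⟩ := hφ₂.1 (ψ₁ y)
      exact ⟨⟨(x, y), hx⟩, rfl⟩
    · have := hφ₂.2.1
      refine Finite.of_injective
        (fun z => (⟨z.1.1.1, ?_⟩ : φ₂.toMonoidHom.ker)) fun z w hzw => ?_
      · have hz : z.1.1.2 = 1 := z.2
        have := z.1.2
        change φ₂ z.1.1.1 = ψ₁ z.1.1.2 at this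
        rw [hz, map_one] at this
        exact this
      · have hz : z.1.1.2 = 1 := z.2
        have hw : w.1.1.2 = 1 := w.2
        exact Subtype.ext (Subtype.ext (Prod.ext (congrArg Subtype.val hzw) (hz.trans hw.symm)))
  exact ⟨_, _, _, IsFiniteCover.comp hφ₁ h1, IsFiniteCover.comp hψ₂ h2⟩

/-- The homomorphism of quotient pairs induced by an equivariant homomorphism. -/
def quotientMap (f : P →ₜ* Q) (N : P.StableSubgroup) (hN : N.toSubgroup.Normal)
    (M : Q.StableSubgroup) (hM : M.toSubgroup.Normal)
    (h : N.toSubgroup ≤ M.toSubgroup.comap f.toMonoidHom) :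
    P.quotient N hN →ₜ* Q.quotient M hM :=
  letI := hN
  letI := hM
  { toMonoidHom := QuotientGroup.map N.toSubgroup M.toSubgroup f.toMonoidHom h
    continuous_toFun := (QuotientGroup.isQuotientMap_mk N.toSubgroup).continuous_iff.mpr
      (QuotientGroup.continuous_mk.comp f.continuous) }

theorem isFiniteCover_quotientMap (f : P →ₜ* Q) (hf : ∀ x, f (P.aut x) = Q.aut (f x))
    (N : P.StableSubgroup) (hN : N.toSubgroup.Normal)
    (M : Q.StableSubgroup) (hM : M.toSubgroup.Normal)
    (h : N.toSubgroup ≤ M.toSubgroup.comap f.toMonoidHom)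
    (hs : Function.Surjective ((proj M hM).comp f))
    (hfin : N.toSubgroup.relIndex (M.toSubgroup.comap f.toMonoidHom) ≠ 0) :
    IsFiniteCover (quotientMap f N hN M hM h) := by
  refine ⟨fun y => ?_, ?_, fun x => ?_⟩
  · obtain ⟨x, rfl⟩ := hs y
    exact ⟨proj N hN x, rfl⟩
  · have hker : (quotientMap f N hN M hM h).toMonoidHom.ker =
        (M.toSubgroup.comap f.toMonoidHom).map (proj N hN).toMonoidHom := by
      ext x
      obtain ⟨x, rfl⟩ := proj_surjective N hN x
      constructor
      · intro hx
        exact ⟨x, (proj_eq_one_iff M hM (f x)).1 hx, rfl⟩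
      · rintro ⟨y, hy, hyx⟩
        have h1 : proj N hN y = proj N hN x := hyx
        rw [← h1]
        exact (proj_eq_one_iff M hM (f y)).2 hy
    rw [hker, finite_map_iff_relIndex_ker_ne_zero, ker_proj]
    exact hfin
  · obtain ⟨x, rfl⟩ := proj_surjective N hN x
    exact congrArg (proj M hM) (hf x)

/-- The inclusion between closed stable subgroups. -/
def inclusion {A B : P.StableSubgroup} (h : A.toSubgroup ≤ B.toSubgroup) :
    P.restrict A →ₜ* P.restrict B where
  toMonoidHom := Subgroup.inclusion h
  continuous_toFun := continuous_inclusion h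

theorem StableSubgroup.normal_subgroupOf_iff {A B : P.StableSubgroup}
    (h : A.toSubgroup ≤ B.toSubgroup) : (A.subgroupOf B).toSubgroup.Normal ↔
      ∀ a ∈ A.toSubgroup, ∀ b ∈ B.toSubgroup, b * a * b⁻¹ ∈ A.toSubgroup :=
  (Subgroup.normal_subgroupOf_iff h).trans
    ⟨fun H a ha b hb => H a b ha hb, fun H a b ha hb => H a ha b hb⟩

theorem StableSubgroup.relIndex_subgroupOf {A B D : P.StableSubgroup}
    (h : B.toSubgroup ≤ D.toSubgroup) :
    (A.subgroupOf D).toSubgroup.relIndex (B.subgroupOf D).toSubgroup =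
      A.toSubgroup.relIndex B.toSubgroup :=
  Subgroup.relIndex_subgroupOf h

/-- `A` is a normal subgroup of `B` with irreducible quotient pair. -/
def IsMaximalIn (A B : P.StableSubgroup) : Prop :=
  A.toSubgroup ≤ B.toSubgroup ∧ ∃ hn : (A.subgroupOf B).toSubgroup.Normal,
    ((P.restrict B).quotient (A.subgroupOf B) hn).IsIrreducible

theorem relIndex_eq_zero_of_infinite_quotient {A B : P.StableSubgroup}
    {hn : (A.subgroupOf B).toSubgroup.Normal}
    (h : Infinite ((P.restrict B).quotient (A.subgroupOf B) hn)) :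
    A.toSubgroup.relIndex B.toSubgroup = 0 := by
  have : Infinite (P.restrict B ⧸ (A.subgroupOf B).toSubgroup) := h
  exact (Subgroup.index_eq_zero_iff_infinite (H := (A.subgroupOf B).toSubgroup)).2 this

theorem IsMaximalIn.ne {A B : P.StableSubgroup} (h : IsMaximalIn A B) : A ≠ B := by
  rintro rfl
  obtain ⟨_, hn, hi, -⟩ := h
  have := relIndex_eq_zero_of_infinite_quotient hi
  simp at this

/-- By irreducibility the proper normal subgroup `W / A` of `B / A` is finite, and a transitive `W`
has no proper closed stable subgroup of finite index. -/
theorem IsMaximalIn.eq_of_le {A W B : P.StableSubgroup} (h : IsMaximalIn A B)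
    (hAW : A.toSubgroup ≤ W.toSubgroup) (hWB : W.toSubgroup ≤ B.toSubgroup)
    (hn : (W.subgroupOf B).toSubgroup.Normal) (hne : W ≠ B)
    (hW : (P.restrict W).IsTopologicallyTransitive) : A = W := by
  obtain ⟨_, hA, -, hirr⟩ := h
  set π := proj (A.subgroupOf B) hA
  have hfin := hirr ((W.subgroupOf B).map π fun _ => rfl)
    (hn.map π.toMonoidHom (proj_surjective _ hA)) (by
      intro htop
      apply hne
      refine StableSubgroup.ext (le_antisymm hWB fun b hb => ?_)
      obtain ⟨b, rfl⟩ := exists_incl_eq B hb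
      have hb' : π b ∈ ((W.subgroupOf B).map π fun _ => rfl).toSubgroup := htop ▸ Subgroup.mem_top _
      obtain ⟨w, hw, hwb⟩ := hb'
      have h1 : π (w⁻¹ * b) = 1 := by
        rw [map_mul, map_inv, inv_mul_eq_one]
        exact hwb
      have h2 : incl B (w⁻¹ * b) ∈ W.toSubgroup :=
        hAW ((proj_eq_one_iff (A.subgroupOf B) hA _).1 h1)
      rw [map_mul, map_inv] at h2
      exact (W.toSubgroup.mul_mem_cancel_left (W.toSubgroup.inv_mem hw)).1 h2)
  have h1 : Finite ((W.subgroupOf B).toSubgroup.map π.toMonoidHom) := hfin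
  rw [finite_map_iff_relIndex_ker_ne_zero, ker_proj, StableSubgroup.relIndex_subgroupOf hWB] at h1
  exact hW.eq_of_relIndex_ne_zero hAW h1

theorem conj_mem_closure {H : Subgroup P} {g : P} (h : ∀ x ∈ H, g * x * g⁻¹ ∈ H) {x : P}
    (hx : x ∈ H.topologicalClosure) : g * x * g⁻¹ ∈ H.topologicalClosure :=
  map_mem_closure (f := fun x => g * x * g⁻¹) (by fun_prop) hx h

theorem Coding.conj_mem_core (C : P.Coding) {H : P.StableSubgroup} {g : P}
    (h : ∀ x ∈ H.toSubgroup, g * x * g⁻¹ ∈ H.toSubgroup) {x : P}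
    (hx : x ∈ (C.core H).toSubgroup) : g * x * g⁻¹ ∈ (C.core H).toSubgroup :=
  conj_mem_closure (H := H.toSubgroup ⊓ C.homoclinic) (fun y hy => ⟨h y hy.1, Subgroup.Normal.conj_mem inferInstance y hy.2 g⟩) hx

theorem StableSubgroup.conj_mem_join {A B : P.StableSubgroup} {g : P}
    (hA : ∀ x ∈ A.toSubgroup, g * x * g⁻¹ ∈ A.toSubgroup)
    (hB : ∀ x ∈ B.toSubgroup, g * x * g⁻¹ ∈ B.toSubgroup) {x : P}
    (hx : x ∈ (A.join B).toSubgroup) : g * x * g⁻¹ ∈ (A.join B).toSubgroup := by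
  refine conj_mem_closure (fun y hy => ?_) hx
  have : A.toSubgroup ⊔ B.toSubgroup ≤
      (A.toSubgroup ⊔ B.toSubgroup).comap (MulAut.conj g).toMonoidHom :=
    sup_le (fun a ha => le_sup_left (a := A.toSubgroup) (hA a ha))
      (fun b hb => le_sup_right (a := A.toSubgroup) (hB b hb))
  exact this hy

theorem StableSubgroup.le_join_left (A B : P.StableSubgroup) :
    A.toSubgroup ≤ (A.join B).toSubgroup :=
  le_sup_left.trans (Subgroup.le_topologicalClosure _)

theorem StableSubgroup.le_join_right (A B : P.StableSubgroup) :
    B.toSubgroup ≤ (A.join B).toSubgroup :=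
  le_sup_right.trans (Subgroup.le_topologicalClosure _)

theorem StableSubgroup.join_le {A B D : P.StableSubgroup} (hA : A.toSubgroup ≤ D.toSubgroup)
    (hB : B.toSubgroup ≤ D.toSubgroup) : (A.join B).toSubgroup ≤ D.toSubgroup :=
  Subgroup.topologicalClosure_minimal _ (sup_le hA hB) D.isClosed

/-- The second isomorphism theorem, up to a finite kernel. -/
theorem Coding.exists_isFiniteCover_core_inter (C : P.Coding) {A B : P.StableSubgroup}
    (hA : (A.subgroupOf (A.join B)).toSubgroup.Normal) :
    ∃ (hn : ((C.core (A.inter B)).subgroupOf B).toSubgroup.Normal)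
      (φ : (P.restrict B).quotient _ hn →ₜ* (P.restrict (A.join B)).quotient _ hA),
      IsFiniteCover φ := by
  have hconj := (StableSubgroup.normal_subgroupOf_iff (A.le_join_left B)).1 hA
  have hDB : (C.core (A.inter B)).toSubgroup ≤ B.toSubgroup := (C.core_le _).trans inf_le_right
  have hn : ((C.core (A.inter B)).subgroupOf B).toSubgroup.Normal := by
    rw [StableSubgroup.normal_subgroupOf_iff hDB]
    intro d hd b hb
    refine C.conj_mem_core (H := A.inter B) (fun x hx => ⟨hconj x hx.1 b (A.le_join_right B hb), ?_⟩) hd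
    exact B.toSubgroup.mul_mem (B.toSubgroup.mul_mem hb hx.2) (B.toSubgroup.inv_mem hb)
  have hle : ((C.core (A.inter B)).subgroupOf B).toSubgroup ≤
      (A.subgroupOf (A.join B)).toSubgroup.comap (inclusion (A.le_join_right B)).toMonoidHom :=
    fun x hx => ((C.core_le _) hx).1
  refine ⟨hn, quotientMap (inclusion (A.le_join_right B)) _ hn _ hA hle,
    isFiniteCover_quotientMap _ (fun _ => rfl) _ hn _ hA hle ?_ ?_⟩
  · set f := (proj (A.subgroupOf (A.join B)) hA).comp (inclusion (A.le_join_right B))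
    -- `Y` is the preimage in the join of the image of `B` modulo `A`. It is closed by compactness
    -- and contains `A` and `B`, so it is the whole join; this is surjectivity.
    set Y : P.StableSubgroup := (((StableSubgroup.top (P.restrict B)).map f fun _ => rfl).comap
      (proj (A.subgroupOf (A.join B)) hA) fun _ => rfl).map (incl _) fun _ => rfl
    have hAY : A.toSubgroup ≤ Y.toSubgroup := by
      intro a ha
      obtain ⟨a, rfl⟩ := exists_incl_eq _ (A.le_join_left B ha)
      refine ⟨a, ⟨1, Subgroup.mem_top _, ?_⟩, rfl⟩
      exact (map_one f).trans ((proj_eq_one_iff _ hA a).2 ha).symm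
    have hBY : B.toSubgroup ≤ Y.toSubgroup := fun b hb =>
      ⟨⟨b, A.le_join_right B hb⟩, ⟨⟨b, hb⟩, Subgroup.mem_top _, rfl⟩, rfl⟩
    intro w
    obtain ⟨w, rfl⟩ := proj_surjective _ hA w
    obtain ⟨w', ⟨b, -, hb⟩, hw'⟩ := StableSubgroup.join_le hAY hBY (incl_mem _ w)
    rw [← incl_injective _ hw']
    exact ⟨b, hb⟩
  -- The kernel is the quotient of `A ∩ B` by its core, which is finite.
  · have h1 : (A.subgroupOf (A.join B)).toSubgroup.comap
        (inclusion (A.le_join_right B)).toMonoidHom = ((A.inter B).subgroupOf B).toSubgroup := by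
      ext x
      exact ⟨fun hx => ⟨hx, x.2⟩, fun hx => hx.1⟩
    rw [h1, StableSubgroup.relIndex_subgroupOf inf_le_right]
    exact C.core_relIndex_ne_zero _

/-- Every transitive stable subgroup `B ≠ 1` has a transitive normal subgroup with irreducible
quotient. -/
theorem Coding.exists_isMaximalIn (C : P.Coding) {B : P.StableSubgroup}
    (hB : (P.restrict B).IsTopologicallyTransitive) (hne : B.toSubgroup ≠ ⊥) :
    ∃ A, (P.restrict A).IsTopologicallyTransitive ∧ IsMaximalIn A B := by
  let T : Set P.StableSubgroup := {A | (P.restrict A).IsTopologicallyTransitive ∧ A ≠ B ∧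
    A.toSubgroup ≤ B.toSubgroup ∧ (A.subgroupOf B).toSubgroup.Normal}
  have hT : StableSubgroup.bot P ∈ T := by
    refine ⟨C.transitive_bot, fun h => hne (h ▸ rfl), bot_le, ?_⟩
    rw [StableSubgroup.normal_subgroupOf_iff bot_le]
    intro a ha b _
    have ha : a = 1 := ha
    rw [ha, mul_one, mul_inv_cancel]
    exact one_mem _
  -- A member of `T` with the most leading symbols is taken as `A`; the alphabet bounds this number.
  let rank : P.StableSubgroup → ℕ := fun A => Nat.card (C.leading A.toSubgroup)
  have hbdd : (rank '' T).Finite :=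
    (Set.finite_Iic (Nat.card (P ⧸ C.window))).subset (by
      rintro _ ⟨A, -, rfl⟩
      exact C.card_leading_le _)
  obtain ⟨_, ⟨A, ⟨hAt, hAne, hAB, hAn⟩, rfl⟩, hmax⟩ :=
    hbdd.exists_le_maximal (Set.mem_image_of_mem rank hT) |>.imp fun _ h => h.2
  refine ⟨A, hAt, hAB, hAn, ?_, fun N hN hNtop => ?_⟩
  · by_contra hfin
    rw [not_infinite_iff_finite] at hfin
    apply hAne
    refine hB.eq_of_relIndex_ne_zero hAB ?_
    have : Finite (P.restrict B ⧸ (A.subgroupOf B).toSubgroup) := hfin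
    exact (Subgroup.finiteIndex_of_finite_quotient
      (H := (A.subgroupOf B).toSubgroup)).index_ne_zero
  · set π := proj (A.subgroupOf B) hAn with hπ
    set M := N.comap π fun _ => rfl
    set M' := M.map (incl B) fun _ => rfl
    have hM'B : M'.toSubgroup ≤ B.toSubgroup := by
      rintro _ ⟨x, -, rfl⟩
      exact x.2
    have hM'n : ∀ a ∈ M'.toSubgroup, ∀ b ∈ B.toSubgroup, b * a * b⁻¹ ∈ M'.toSubgroup := by
      rintro _ ⟨a, ha, rfl⟩ b hb
      obtain ⟨b, rfl⟩ := exists_incl_eq B hb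
      exact ⟨b * a * b⁻¹, (hN.comap π.toMonoidHom).conj_mem a ha b, rfl⟩
    have hsub : (M'.subgroupOf B).toSubgroup = M.toSubgroup := by
      ext x
      constructor
      · rintro ⟨y, hy, hyx⟩
        rwa [← incl_injective B hyx]
      · exact fun hx => ⟨x, hx, rfl⟩
    have hAM' : A.toSubgroup ≤ M'.toSubgroup := by
      intro a ha
      obtain ⟨a, rfl⟩ := exists_incl_eq B (hAB ha)
      refine ⟨a, ?_, rfl⟩
      have h1 : π a = 1 := (proj_eq_one_iff _ hAn a).2 ha
      change π a ∈ N.toSubgroup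
      rw [h1]
      exact N.toSubgroup.one_mem
    -- The preimage `M'` of `N` in `B` need not be transitive, but its core is, and it still
    -- contains `A`. Maximality of the rank forces `A = W`, so `N = M' / W` is finite.
    set W := C.core M' with hW
    have hWM' : W.toSubgroup ≤ M'.toSubgroup := C.core_le M'
    have hAW : A.toSubgroup ≤ W.toSubgroup :=
      (congrArg _ (C.core_eq_of_transitive hAt)).symm.le.trans (C.core_mono hAM')
    have hWT : W ∈ T := by
      refine ⟨C.transitive_core _, ?_, hWM'.trans hM'B, ?_⟩
      · intro h
        apply hNtop
        rw [eq_top_iff]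
        intro x _
        obtain ⟨x, rfl⟩ := proj_surjective _ hAn x
        have hBM' : B.toSubgroup ≤ M'.toSubgroup := (congrArg _ h).symm.le.trans hWM'
        have : x ∈ (M'.subgroupOf B).toSubgroup := hBM' x.2
        rw [hsub] at this
        exact this
      · rw [StableSubgroup.normal_subgroupOf_iff (hWM'.trans hM'B)]
        exact fun a ha b hb => C.conj_mem_core (fun x hx => hM'n x hx b hb) ha
    have hAeq : A = W := by
      by_contra hAW'
      have h1 := C.card_leading_lt hAW (C.transitive_core _) hAW'
      exact absurd (hmax ⟨W, hWT, rfl⟩ h1.le) h1.not_ge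
    have hNeq : N.toSubgroup = M.toSubgroup.map π.toMonoidHom :=
      (Subgroup.map_comap_eq_self_of_surjective (proj_surjective _ hAn) _).symm
    rw [hNeq, finite_map_iff_relIndex_ker_ne_zero, hπ, ker_proj, ← hsub,
      StableSubgroup.relIndex_subgroupOf hM'B, hAeq]
    exact C.core_relIndex_ne_zero M'

end CompactPair

/-! ### The Jordan–Hölder lattice of transitive subgroups -/

namespace CompactPair

variable {P : CompactPair.{u}}

/-- The closed stable topologically transitive subgroups of a compact pair with a coding. -/
def TransitiveSubgroup (_C : P.Coding) : Type u :=
  {H : P.StableSubgroup // (P.restrict H).IsTopologicallyTransitive}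

namespace TransitiveSubgroup

variable {C : P.Coding}

/-- The meet is the core of the intersection, because a transitive subgroup of the intersection
equals its own core and so lies in that core. -/
instance : Lattice (TransitiveSubgroup C) where
  le A B := A.1.toSubgroup ≤ B.1.toSubgroup
  le_refl _ := le_rfl
  le_trans _ _ _ := le_trans
  le_antisymm _ _ h h' := Subtype.ext (StableSubgroup.ext (le_antisymm h h'))
  sup A B := ⟨A.1.join B.1, C.transitive_join A.2 B.2⟩
  le_sup_left A B := A.1.le_join_left B.1
  le_sup_right A B := A.1.le_join_right B.1
  sup_le _ _ _ := StableSubgroup.join_le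
  inf A B := ⟨C.core (A.1.inter B.1), C.transitive_core _⟩
  inf_le_left _ _ := (C.core_le _).trans inf_le_left
  inf_le_right _ _ := (C.core_le _).trans inf_le_right
  le_inf A B D hB hD := by
    refine (congrArg _ (C.core_eq_of_transitive A.2)).symm.le.trans (C.core_mono ?_)
    exact le_inf hB hD

/-- If the join were proper, it would be a transitive normal subgroup above both `A` and `B`, and
maximality would identify it with each of them. -/
theorem eq_sup_of_isMaximalIn {A B D : TransitiveSubgroup C} (hA : IsMaximalIn A.1 D.1)
    (hB : IsMaximalIn B.1 D.1) (hne : A ≠ B) : A ⊔ B = D := by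
  by_contra hD
  have hle : (A ⊔ B).1.toSubgroup ≤ D.1.toSubgroup := StableSubgroup.join_le hA.1 hB.1
  have hn : ((A ⊔ B).1.subgroupOf D.1).toSubgroup.Normal := by
    rw [StableSubgroup.normal_subgroupOf_iff hle]
    obtain ⟨hAD, hA, -⟩ := hA
    obtain ⟨hBD, hB, -⟩ := hB
    rw [StableSubgroup.normal_subgroupOf_iff hAD] at hA
    rw [StableSubgroup.normal_subgroupOf_iff hBD] at hB
    exact fun a ha d hd => StableSubgroup.conj_mem_join (fun x hx => hA x hx d hd)
      (fun x hx => hB x hx d hd) ha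
  have hD' : (A ⊔ B).1 ≠ D.1 := fun h => hD (Subtype.ext h)
  have h1 := hA.eq_of_le (A.1.le_join_left B.1) hle hn hD' (A ⊔ B).2
  have h2 := hB.eq_of_le (A.1.le_join_right B.1) hle hn hD' (A ⊔ B).2
  exact hne (Subtype.ext (h1.trans h2.symm))

/-- The quotient of `B` by the meet is a transitive finite cover of the irreducible quotient of the
join by `A`, and irreducibility lifts to such covers. -/
theorem isMaximalIn_inf_right {A B : TransitiveSubgroup C} (hA : IsMaximalIn A.1 (A ⊔ B).1) :
    IsMaximalIn (A ⊓ B).1 B.1 := by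
  obtain ⟨_, hA, hirr⟩ := hA
  obtain ⟨hn, φ, hφ⟩ := C.exists_isFiniteCover_core_inter hA
  refine ⟨inf_le_right (a := A), hn, IsIrreducible.of_isFiniteCover hirr ?_ hφ⟩
  exact B.2.map (proj _ hn) (proj_aut _ hn) (proj_surjective _ hn)

instance : JordanHolderLattice (TransitiveSubgroup C) where
  IsMaximal A B := IsMaximalIn A.1 B.1
  lt_of_isMaximal {A B} h := lt_of_le_of_ne (a := A) h.1 fun e => h.ne (congrArg _ e)
  sup_eq_of_isMaximal := eq_sup_of_isMaximalIn
  isMaximal_inf_left_of_isMaximal_sup {A B} _ hB := by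
    rw [inf_comm]
    rw [sup_comm] at hB
    exact isMaximalIn_inf_right hB

/-- Two pairs of subgroups are equal or have co-commensurable quotients. -/
def QuotientsCoCommensurable (x y : TransitiveSubgroup C × TransitiveSubgroup C) : Prop :=
  x = y ∨ ∃ (hx : (x.1.1.subgroupOf x.2.1).toSubgroup.Normal)
    (hy : (y.1.1.subgroupOf y.2.1).toSubgroup.Normal),
    CoCommensurable ((P.restrict x.2.1).quotient _ hx) ((P.restrict y.2.1).quotient _ hy)

/-- It suffices to treat the generating isomorphisms, which the second isomorphism theorem provides.
The alternative `x = y` supplies reflexivity for pairs that are not normal and so have no quotient.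
-/
theorem quotientsCoCommensurable_of_iso {x y : TransitiveSubgroup C × TransitiveSubgroup C}
    (h : JordanHolderLattice.Iso x y) : QuotientsCoCommensurable x y := by
  refine JordanHolderLattice.Iso.rel QuotientsCoCommensurable (.inl rfl) ?_ ?_ ?_ h
  · rintro x y (rfl | ⟨hx, hy, h⟩)
    · exact .inl rfl
    · exact .inr ⟨hy, hx, h.symm⟩
  · rintro x y z (rfl | ⟨hx, hy, h⟩) (rfl | ⟨hy', hz, h'⟩)
    · exact .inl rfl
    · exact .inr ⟨hy', hz, h'⟩
    · exact .inr ⟨hx, hy, h⟩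
    · exact .inr ⟨hx, hz, h.trans h'⟩
  · rintro A B ⟨_, hA, -⟩
    obtain ⟨hn, φ, hφ⟩ := C.exists_isFiniteCover_core_inter hA
    exact .inr ⟨hA, hn, _, φ, .id _, hφ, IsFiniteCover.id _⟩

/-- Induction on the number of leading symbols, which drops on passing to a maximal subgroup. -/
theorem exists_compositionSeries (C : P.Coding) (B : TransitiveSubgroup C) :
    ∃ s : CompositionSeries (TransitiveSubgroup C),
      s.head.1.toSubgroup = ⊥ ∧ s.last = B := by
  induction h : Nat.card (C.leading B.1.toSubgroup) using Nat.strong_induction_on generalizing B with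
  | _ n ih =>
    by_cases hB : B.1.toSubgroup = ⊥
    · exact ⟨RelSeries.singleton _ B, hB, rfl⟩
    · obtain ⟨A, hA, hAB⟩ := C.exists_isMaximalIn B.2 hB
      obtain ⟨s, hs, hsl⟩ := ih _ (h ▸ C.card_leading_lt hAB.1 B.2 hAB.ne) ⟨A, hA⟩ rfl
      have hmax : (s.last, B) ∈
          {(x, y) : TransitiveSubgroup C × TransitiveSubgroup C |
            JordanHolderLattice.IsMaximal x y} := by
        rw [hsl]
        exact hAB
      exact ⟨s.snoc B hmax, by rwa [RelSeries.head_snoc], RelSeries.last_snoc _ _ _⟩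

end TransitiveSubgroup

open TransitiveSubgroup

namespace SubnormalSeries

/-- The series in the lattice of transitive subgroups given by a composition series. -/
def toCompositionSeries (C : P.Coding) (S : P.SubnormalSeries) (hS : S.IsComposition) :
    CompositionSeries (TransitiveSubgroup C) where
  length := S.length
  toFun j := ⟨S.term j, S.transitive j⟩
  step j := ⟨S.le j, S.normal j, hS j⟩

/-- The subnormal series given by a series in the lattice of transitive subgroups. -/
def ofCompositionSeries {C : P.Coding} (s : CompositionSeries (TransitiveSubgroup C))
    (h0 : s.head.1.toSubgroup = ⊥) (h1 : s.last.1.toSubgroup = ⊤) : P.SubnormalSeries where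
  length := s.length
  term j := (s j).1
  term_zero := h0
  term_last := h1
  le j := (s.step j).1
  normal j := (s.step j).2.1
  transitive j := (s j).2
  transitive_quotient j := (s j.succ).2.map (proj _ (s.step j).2.1) (proj_aut _ _)
    (proj_surjective _ _)

theorem exists_isComposition (C : P.Coding) (hP : P.IsTopologicallyTransitive) :
    ∃ S : P.SubnormalSeries, S.IsComposition := by
  have htop : (P.restrict (.top P)).IsTopologicallyTransitive :=
    hP.map (Q := P.restrict (.top P))
      { toFun := fun x => ⟨x, Subgroup.mem_top x⟩
        map_one' := rfl
        map_mul' := fun _ _ => rfl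
        continuous_toFun := continuous_id.subtype_mk _ }
      (fun _ => rfl) (fun x => ⟨x.1, rfl⟩)
  obtain ⟨s, hs, hs'⟩ := exists_compositionSeries C ⟨_, htop⟩
  exact ⟨ofCompositionSeries s hs (by rw [hs']; rfl), fun j => (s.step j).2.2⟩

theorem equivalent_of_isComposition (C : P.Coding) {S T : P.SubnormalSeries}
    (hS : S.IsComposition) (hT : T.IsComposition) : S.Equivalent T := by
  obtain ⟨π, hπ⟩ := CompositionSeries.jordan_holder (toCompositionSeries C S hS)
    (toCompositionSeries C T hT)
    (Subtype.ext (StableSubgroup.ext (S.term_zero.trans T.term_zero.symm)))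
    (Subtype.ext (StableSubgroup.ext (S.term_last.trans T.term_last.symm)))
  refine ⟨Fin.equiv_iff_eq.1 ⟨π⟩, π, fun j => ?_⟩
  rcases quotientsCoCommensurable_of_iso (hπ j) with h | ⟨_, _, h⟩
  · have h1 : S.term j.castSucc = T.term (π j).castSucc := congrArg (fun x => x.1.1) h
    have h2 : S.term j.succ = T.term (π j).succ := congrArg (fun x => x.2.1) h
    have : ∀ {A B A' B' : P.StableSubgroup} (_ : A = A') (_ : B = B')
        (hn : (A.subgroupOf B).toSubgroup.Normal) (hn' : (A'.subgroupOf B').toSubgroup.Normal),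
        CoCommensurable ((P.restrict B).quotient _ hn) ((P.restrict B').quotient _ hn') := by
      rintro A B _ _ rfl rfl hn hn'
      exact CoCommensurable.refl _
    exact this h1 h2 (S.normal j) (T.normal (π j))
  · exact h

end SubnormalSeries

end CompactPair

/-! ### Codings of irreducible subquotients -/

namespace CompactPair

variable {P : CompactPair.{u}}

/-- An irreducible pair with enough open normal subgroups has a coding. -/
theorem IsIrreducible.nonempty_coding (hP : P.IsIrreducible)
    (hsep : ∀ x : P, x ≠ 1 → ∃ W : Subgroup P, W.Normal ∧ IsOpen (W : Set P) ∧ x ∉ W) :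
    Nonempty P.Coding := by
  have := hP.1
  obtain ⟨x₀, hx₀⟩ := exists_ne (1 : P)
  obtain ⟨W, hW, hWo, hxW⟩ := hsep x₀ hx₀
  have hWc : IsClosed (W : Set P) := Subgroup.isClosed_of_isOpen W hWo
  -- The intersection of all translates of `W` is proper, hence finite by irreducibility. Finitely
  -- many further open normal subgroups then separate its elements from `1`.
  set M : P.StableSubgroup := .mk' (⨅ k : ℤ, W.comap (P.autPow k).toMonoidHom)
    (by
      rw [Subgroup.coe_iInf]
      exact isClosed_iInter fun k => hWc.preimage (continuous_autPow k))
    (by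
      intro k x hx
      rw [Subgroup.mem_iInf] at hx ⊢
      intro j
      have := hx (j + k)
      rw [Subgroup.mem_comap] at this ⊢
      change P.autPow j (P.autPow k x) ∈ W
      rwa [autPow_autPow])
  have hMW : M.toSubgroup ≤ W := by
    intro x hx
    have := (Subgroup.mem_iInf.1 hx) 0
    change P.autPow 0 x ∈ W at this
    rwa [autPow_zero] at this
  have hMfin : Finite M.toSubgroup := by
    refine hP.2 M (Subgroup.normal_iInf_normal fun k => hW.comap _) fun h => hxW (hMW ?_)
    rw [h]
    trivial
  have key : ∀ x : M.toSubgroup, ∃ V : Subgroup P, V.Normal ∧ IsOpen (V : Set P) ∧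
      ((x : P) ∈ V → (x : P) = 1) := by
    intro x
    by_cases hx : (x : P) = 1
    · exact ⟨⊤, inferInstance, isOpen_univ, fun _ => hx⟩
    · obtain ⟨V, h1, h2, h3⟩ := hsep x hx
      exact ⟨V, h1, h2, fun h => absurd h h3⟩
  choose V hV1 hV2 hV3 using key
  refine ⟨⟨W ⊓ ⨅ x, V x, ?_, ?_, fun x hx => ?_⟩⟩
  · have := Subgroup.normal_iInf_normal hV1
    infer_instance
  · rw [Subgroup.coe_inf, Subgroup.coe_iInf]
    exact hWo.inter (isOpen_iInter_of_finite hV2)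
  · have hxM : x ∈ M.toSubgroup := Subgroup.mem_iInf.2 fun k => (hx k).1
    have h0 := hx 0
    rw [autPow_zero] at h0
    exact hV3 ⟨x, hxM⟩ (Subgroup.mem_iInf.1 h0.2 _)

namespace Coding

theorem exists_open_normal_not_mem (C : P.Coding) {F : Set P} (hF : IsClosed F) (h1 : 1 ∉ F) :
    ∃ W : Subgroup P, W.Normal ∧ IsOpen (W : Set P) ∧ Disjoint (W : Set P) F := by
  obtain ⟨n, hn⟩ := C.nhds_one_basis (hF.isOpen_compl.mem_nhds h1)
  exact ⟨_, inferInstance, C.isOpen_kerOn (Set.finite_Icc _ _),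
    Set.disjoint_left.2 fun x hx hxF => hn hx hxF⟩

/-- The subquotients of a pair with a coding have enough open normal subgroups. -/
theorem exists_open_normal_subquotient (C : P.Coding) (A B : P.StableSubgroup)
    (hn : (A.subgroupOf B).toSubgroup.Normal)
    (x : (P.restrict B).quotient (A.subgroupOf B) hn) (hx : x ≠ 1) :
    ∃ W : Subgroup ((P.restrict B).quotient (A.subgroupOf B) hn), W.Normal ∧
      IsOpen (W : Set ((P.restrict B).quotient (A.subgroupOf B) hn)) ∧ x ∉ W := by
  obtain ⟨b, rfl⟩ := proj_surjective _ hn x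
  rw [Ne, proj_eq_one_iff] at hx
  have hb : incl B b ∉ A.toSubgroup := hx
  obtain ⟨W, hW, hWo, hWd⟩ := C.exists_open_normal_not_mem
    (F := (fun y => (incl B b)⁻¹ * y) ⁻¹' (A.toSubgroup : Set P))
    (A.isClosed.preimage (by fun_prop))
    (by simpa using hb)
  refine ⟨(W.comap (incl B).toMonoidHom).map (proj _ hn).toMonoidHom,
    (hW.comap _).map _ (proj_surjective _ hn), ?_, ?_⟩
  · rw [Subgroup.coe_map]
    exact isOpenMap_proj _ hn _ (hWo.preimage (incl B).continuous)
  · rintro ⟨w, hw, hwb⟩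
    refine Set.disjoint_left.1 hWd hw ?_
    have h1 : proj _ hn (b⁻¹ * w) = 1 := by
      rw [map_mul, map_inv, inv_mul_eq_one]
      exact hwb.symm
    exact (proj_eq_one_iff _ hn _).1 h1

/-! ### Generation by elements of shortest support -/

variable (C : P.Coding)

theorem exists_ne_one_of_transitive [Nontrivial P] (hP : P.IsTopologicallyTransitive) :
    ∃ x ∈ C.homoclinic, x ≠ 1 := by
  have h := hP.eq_top_of_finiteIndex (C.core (.top P))
    ⟨by rw [← Subgroup.relIndex_top_right]; exact C.core_relIndex_ne_zero (.top P)⟩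
  by_contra! hcon
  have h1 : (C.core (.top P)).toSubgroup ≤ ⊥ :=
    Subgroup.topologicalClosure_minimal _ (fun x hx => hcon x hx.2) (by simp)
  rw [h, top_le_iff] at h1
  exact bot_ne_top h1

/-- The closed subgroup topologically generated by the translates with index in `S` of the group
of elements supported in `[0, m)`. -/
def gen (m : ℕ) (S : Set ℤ) : Subgroup P :=
  (⨆ j ∈ S, C.kerOn (Set.Ico j (j + m))ᶜ).topologicalClosure

variable {C}

instance (m : ℕ) (S : Set ℤ) : (C.gen m S).Normal :=
  have : (⨆ j ∈ S, C.kerOn (Set.Ico j (j + m))ᶜ).Normal := by infer_instance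
  Subgroup.is_normal_topologicalClosure _

theorem kerOn_le_gen {m : ℕ} {S : Set ℤ} {j : ℤ} (hj : j ∈ S) :
    C.kerOn (Set.Ico j (j + m))ᶜ ≤ C.gen m S :=
  (le_biSup (fun j : ℤ => C.kerOn (Set.Ico j (j + m))ᶜ) hj).trans (Subgroup.le_topologicalClosure _)

theorem gen_le {m : ℕ} {S : Set ℤ} {H : Subgroup P} (hH : IsClosed (H : Set P))
    (h : ∀ j ∈ S, C.kerOn (Set.Ico j (j + m))ᶜ ≤ H) : C.gen m S ≤ H :=
  Subgroup.topologicalClosure_minimal _ (iSup₂_le h) hH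

theorem gen_mono {m : ℕ} {S T : Set ℤ} (h : S ⊆ T) : C.gen m S ≤ C.gen m T :=
  gen_le (Subgroup.isClosed_topologicalClosure _) fun _ hj => kerOn_le_gen (h hj)

theorem autPow_mem_kerOn_compl_Ico {m : ℕ} {j : ℤ} (k : ℤ) {x : P}
    (hx : x ∈ C.kerOn (Set.Ico j (j + m))ᶜ) :
    P.autPow k x ∈ C.kerOn (Set.Ico (j - k) (j - k + m))ᶜ := by
  refine C.autPow_mem_kerOn.2 (C.kerOn_anti ?_ hx)
  rintro _ ⟨i, hi, rfl⟩
  simp only [Set.mem_compl_iff, Set.mem_Ico] at hi ⊢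
  omega

theorem autPow_mem_gen {m : ℕ} {S T : Set ℤ} {k : ℤ} (h : ∀ j ∈ S, j - k ∈ T) {x : P}
    (hx : x ∈ C.gen m S) : P.autPow k x ∈ C.gen m T := by
  have : C.gen m S ≤ (C.gen m T).comap (P.autPow k).toMonoidHom :=
    gen_le ((Subgroup.isClosed_topologicalClosure _).preimage (continuous_autPow k))
      fun j hj x hx => kerOn_le_gen (h j hj) (autPow_mem_kerOn_compl_Ico k hx)
  exact this hx

theorem gen_Ici_le (m : ℕ) (a : ℤ) : C.gen m (Set.Ici a) ≤ C.kerOn (Set.Iio a) :=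
  gen_le (C.isClosed_kerOn _) fun j hj => C.kerOn_anti fun i hi => by
    simp only [Set.mem_compl_iff, Set.mem_Ico, Set.mem_Iio, Set.mem_Ici] at hi hj ⊢
    omega

theorem gen_Iio_le (m : ℕ) (a : ℤ) : C.gen m (Set.Iio a) ≤ C.kerOn (Set.Ici (a + m - 1)) :=
  gen_le (C.isClosed_kerOn _) fun j hj => C.kerOn_anti fun i hi => by
    simp only [Set.mem_compl_iff, Set.mem_Ico, Set.mem_Iio, Set.mem_Ici] at hi hj ⊢
    omega

theorem isClosed_gen_sup (m : ℕ) (S : Set ℤ) {H : Subgroup P} (hH : IsClosed (H : Set P)) :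
    IsClosed ((H ⊔ C.gen m S : Subgroup P) : Set P) := by
  rw [Subgroup.mul_normal]
  exact (hH.isCompact.mul (Subgroup.isClosed_topologicalClosure _).isCompact).isClosed

/-- Distinct translates of a nontrivial homoclinic element are distinct. -/
theorem injective_autPow_of_mem_right {x : P} (hx : x ∈ C.right) (hne : x ≠ 1) :
    Function.Injective fun k : ℤ => P.autPow k x := by
  have key : ∀ d : ℤ, 0 < d → P.autPow d x ≠ x := by
    intro d hd h
    have hn : ∀ n : ℕ, P.autPow (n * d) x = x := by
      intro n
      induction n with
      | zero => simp
      | succ n ih => rw [Nat.cast_succ, add_mul, one_mul, autPow_add, h, ih]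
    obtain ⟨b, hb⟩ := hx
    refine hne (C.eq_one_of_coord fun i => ?_)
    rw [← hn (i.natAbs + b.natAbs), coord_autPow]
    refine C.mem_kerOn.1 hb _ ?_
    have : ((i.natAbs + b.natAbs : ℕ) : ℤ) ≤ ((i.natAbs + b.natAbs : ℕ) : ℤ) * d :=
      le_mul_of_one_le_right (by positivity) hd
    simp only [Set.mem_Ici]
    omega
  have key' : ∀ p q : ℤ, p < q → P.autPow p x ≠ P.autPow q x := by
    intro p q hpq h
    refine key (q - p) (by omega) ((P.autPow p).injective ?_)
    rw [autPow_autPow, add_sub_cancel, h]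
  intro p q h
  rcases lt_trichotomy p q with h1 | h1 | h1
  · exact absurd h (key' p q h1)
  · exact h1
  · exact absurd h.symm (key' q p h1)

/-- The generated group is closed, normal and stable, and it contains the infinitely many distinct
translates of `x`. Irreducibility leaves only the whole group. -/
theorem gen_univ_eq_top (hP : P.IsIrreducible) {m : ℕ} {x : P}
    (hx : x ∈ C.kerOn (Set.Ico (0 : ℤ) (0 + m))ᶜ) (hne : x ≠ 1) : C.gen m Set.univ = ⊤ := by
  by_contra htop
  have hfin : Finite (C.gen m Set.univ) :=
    hP.2 (.mk' (C.gen m Set.univ) (Subgroup.isClosed_topologicalClosure _)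
      fun k x hx => autPow_mem_gen (fun _ _ => Set.mem_univ _) hx)
      (inferInstanceAs (C.gen m Set.univ).Normal) htop
  have hr : x ∈ C.right := ⟨m, C.kerOn_anti (fun i hi => by
    simp only [Set.mem_compl_iff, Set.mem_Ico, Set.mem_Ici] at hi ⊢
    omega) hx⟩
  have hmem : x ∈ C.gen m Set.univ := kerOn_le_gen (Set.mem_univ 0) hx
  have hinj : Function.Injective fun k : ℤ =>
      (⟨P.autPow k x, autPow_mem_gen (fun _ _ => Set.mem_univ _) hmem⟩ : C.gen m Set.univ) :=
    fun p q h => injective_autPow_of_mem_right hr hne (congrArg Subtype.val h)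
  exact not_finite_iff_infinite.2 inferInstance (Finite.of_injective _ hinj)

/-- The subgroup topologically generated by all translates but the one with index `a`. -/
def genCompl (C : P.Coding) (m : ℕ) (a : ℤ) : Subgroup P :=
  C.gen m (Set.Iio a) ⊔ C.gen m (Set.Ioi a)

instance (m : ℕ) (a : ℤ) : (C.genCompl m a).Normal :=
  Subgroup.sup_normal _ _

theorem isClosed_genCompl (m : ℕ) (a : ℤ) : IsClosed (C.genCompl m a : Set P) :=
  isClosed_gen_sup m _ (Subgroup.isClosed_topologicalClosure _)

theorem kerOn_le_genCompl {m : ℕ} {a j : ℤ} (h : j ≠ a) :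
    C.kerOn (Set.Ico j (j + m))ᶜ ≤ C.genCompl m a := by
  rcases lt_or_gt_of_ne h with h | h
  · exact (kerOn_le_gen (Set.mem_Iio.2 h)).trans le_sup_left
  · exact (kerOn_le_gen (Set.mem_Ioi.2 h)).trans le_sup_right

theorem autPow_mem_genCompl {m : ℕ} {a k : ℤ} {x : P} (hx : x ∈ C.genCompl m a) :
    P.autPow k x ∈ C.genCompl m (a - k) := by
  obtain ⟨d, hd, e, he, rfl⟩ := Subgroup.mem_sup_of_normal_right.1 hx
  rw [map_mul]
  refine Subgroup.mem_sup_of_normal_right.2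
    ⟨_, autPow_mem_gen (fun j hj => ?_) hd, _, autPow_mem_gen (fun j hj => ?_) he, rfl⟩
  · simpa using hj
  · simpa using hj

theorem genCompl_sup_eq_top {m : ℕ} (h : C.gen m Set.univ = ⊤) (a : ℤ) :
    C.genCompl m a ⊔ C.kerOn (Set.Ico a (a + m))ᶜ = ⊤ := by
  rw [eq_top_iff, ← h]
  refine gen_le ?_ fun j _ => ?_
  · rw [Subgroup.mul_normal]
    exact ((isClosed_genCompl m a).isCompact.mul (C.isClosed_kerOn _).isCompact).isClosed
  · by_cases hj : j = a
    · exact hj ▸ le_sup_right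
    · exact (kerOn_le_genCompl hj).trans le_sup_left

/-- The omitted translate consists of elements supported on a finite interval, hence is a finite
group, and together with `genCompl` it gives everything. -/
theorem finiteIndex_genCompl {m : ℕ} (h : C.gen m Set.univ = ⊤) (a : ℤ) :
    (C.genCompl m a).FiniteIndex := by
  constructor
  rw [← Subgroup.relIndex_top_right, ← genCompl_sup_eq_top h a, sup_comm,
    Subgroup.relIndex_sup_right]
  refine C.relIndex_ne_zero_of_le (Set.finite_Ico a (a + m)) ?_
  rintro x ⟨hx, hx'⟩
  rw [C.eq_one_of_mem_kerOn (Set.compl_union_self _) hx hx']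
  exact Subgroup.one_mem _

theorem isOpen_genCompl {m : ℕ} (h : C.gen m Set.univ = ⊤) (a : ℤ) :
    IsOpen (C.genCompl m a : Set P) :=
  have := finiteIndex_genCompl h a
  Subgroup.isOpen_of_isClosed_of_finiteIndex _ (isClosed_genCompl m a)

/-- If no nontrivial element has support of length less than `m`, then the subgroups `genCompl`
intersect trivially. -/
theorem eq_one_of_forall_mem_genCompl {m : ℕ} (h : C.gen m Set.univ = ⊤)
    (hmin : ∀ a : ℤ, ∀ x ∈ C.kerOn (Set.Ico a (a + m - 1))ᶜ, x = 1) {x : P}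
    (hx : ∀ a, x ∈ C.genCompl m a) : x = 1 := by
  -- Generators starting before `a` end before `a + m - 1`, so a common element has support of
  -- length `m - 1` and is trivial. Hence a factorization into a left and a right part is unique.
  have hdisj : ∀ (a : ℤ) (y : P), y ∈ C.gen m (Set.Iio a) → y ∈ C.gen m (Set.Ici a) → y = 1 := by
    intro a y h1 h2
    refine hmin a y (C.mem_kerOn.2 fun i hi => ?_)
    rcases lt_or_ge i a with hia | hia
    · exact C.mem_kerOn.1 (gen_Ici_le m a h2) i hia
    · refine C.mem_kerOn.1 (gen_Iio_le m a h1) i ?_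
      simp only [Set.mem_compl_iff, Set.mem_Ico, Set.mem_Ici] at hi ⊢
      omega
  have hIoi : ∀ a : ℤ, Set.Ioi a = Set.Ici (a + 1) := fun a => by
    ext i
    simp only [Set.mem_Ioi, Set.mem_Ici]
    omega
  -- Membership of `x` in `genCompl` at `a` gives a second factorization, whose right part starts at
  -- `a + 1`. By uniqueness it is the given one, so the right part `e` can be pushed to the right
  -- indefinitely and is trivial.
  have hstep : ∀ (a : ℤ) (d e : P), d ∈ C.gen m (Set.Iio a) → e ∈ C.gen m (Set.Ici a) →
      d * e = x → e ∈ C.gen m (Set.Ici (a + 1)) := by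
    intro a d e hd he hde
    obtain ⟨d', hd', e', he', hde'⟩ := Subgroup.mem_sup_of_normal_right.1 (hx a)
    have he'' : e' ∈ C.gen m (Set.Ici a) := gen_mono Set.Ioi_subset_Ici_self he'
    have h1 : d'⁻¹ * d = e' * e⁻¹ := by
      rw [inv_mul_eq_iff_eq_mul, ← mul_assoc, eq_mul_inv_iff_mul_eq, hde, hde']
    have h2 := hdisj a (d'⁻¹ * d) (mul_mem (inv_mem hd') hd)
      (h1 ▸ mul_mem he'' (inv_mem he))
    rw [h1, mul_inv_eq_one] at h2
    rw [← h2, ← hIoi]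
    exact he'
  have hD : ∀ a : ℤ, x ∈ C.gen m (Set.Iio a) := by
    intro a
    have htop : C.gen m (Set.Iio a) ⊔ C.gen m (Set.Ici a) = ⊤ := by
      rw [eq_top_iff, ← h]
      refine gen_le (isClosed_gen_sup m _ (Subgroup.isClosed_topologicalClosure _)) fun j _ => ?_
      rcases lt_or_ge j a with hj | hj
      · exact (kerOn_le_gen (Set.mem_Iio.2 hj)).trans le_sup_left
      · exact (kerOn_le_gen (Set.mem_Ici.2 hj)).trans le_sup_right
    obtain ⟨d, hd, e, he, hde⟩ :=
      Subgroup.mem_sup_of_normal_right.1 (htop ▸ Subgroup.mem_top x)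
    have hen : ∀ n : ℕ, e ∈ C.gen m (Set.Ici (a + n)) := by
      intro n
      induction n with
      | zero => simpa using he
      | succ n ih =>
        rw [Nat.cast_succ, ← add_assoc]
        exact hstep _ d e (gen_mono (Set.Iio_subset_Iio (by omega)) hd) ih hde
    have he1 : e = 1 := C.eq_one_of_coord fun i =>
      C.mem_kerOn.1 (gen_Ici_le m _ (hen (i - a + 1).toNat)) i (by
        simp only [Set.mem_Iio]
        omega)
    rw [← hde, he1, mul_one]
    exact hd
  -- Now `x` lies in every left part. The bound `i + 1 - m` is the one for which the left part
  -- vanishes from index `i` on.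
  exact C.eq_one_of_coord fun i => C.mem_kerOn.1 (gen_Iio_le m _ (hD (i + 1 - m))) i (by
    simp only [Set.mem_Ici]
    omega)

/-- By compactness only finitely many values need to be prescribed. Every coset has a representative
supported in `[0, m)`; multiplying by its translate corrects one value and leaves the others, since
its remaining translates lie in `genCompl`. -/
theorem exists_forall_mk_eq {m : ℕ} (h : C.gen m Set.univ = ⊤)
    (f : ℤ → P ⧸ C.genCompl m 0) :
    ∃ x : P, ∀ k, (QuotientGroup.mk (P.autPow k x) : P ⧸ C.genCompl m 0) = f k := by
  classical
  have hd : DiscreteTopology (P ⧸ C.genCompl m 0) :=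
    QuotientGroup.discreteTopology (isOpen_genCompl h 0)
  have hcl : ∀ k : ℤ, IsClosed {x : P | (QuotientGroup.mk (P.autPow k x) :
      P ⧸ C.genCompl m 0) = f k} := fun k =>
    (isClosed_discrete {f k}).preimage (QuotientGroup.continuous_mk.comp (continuous_autPow k))
  obtain ⟨x, hx⟩ := CompactSpace.iInter_nonempty hcl fun s => by
    induction s using Finset.induction_on with
    | empty => exact ⟨1, by simp⟩
    | insert a s has ih =>
      obtain ⟨x, hx⟩ := ih
      simp only [Set.mem_iInter] at hx
      obtain ⟨y, hy⟩ := QuotientGroup.mk_surjective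
        ((QuotientGroup.mk (P.autPow a x) : P ⧸ C.genCompl m 0)⁻¹ * f a)
      obtain ⟨c, hc, b, hb, rfl⟩ := Subgroup.mem_sup_of_normal_right.1
        (genCompl_sup_eq_top h 0 ▸ Subgroup.mem_top y)
      rw [QuotientGroup.mk_mul, (QuotientGroup.eq_one_iff c).2 hc, one_mul] at hy
      refine ⟨x * P.autPow (-a) b, ?_⟩
      simp only [Set.mem_iInter]
      intro k hk
      rw [Set.mem_ofPred_eq, map_mul, QuotientGroup.mk_mul, autPow_autPow]
      rcases Finset.mem_insert.1 hk with rfl | hk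
      · rw [add_neg_cancel, autPow_zero, hy, mul_inv_cancel_left]
      · have hka : a ≠ k := fun e => has (e ▸ hk)
        have := autPow_mem_kerOn_compl_Ico (k + -a) hb
        rw [(QuotientGroup.eq_one_iff _).2 (kerOn_le_genCompl (by omega) this), mul_one]
        exact hx k hk
  exact ⟨x, fun k => Set.mem_iInter.1 hx k⟩

end Coding

/-! ### Irreducible pairs are shifts over finite simple groups -/

/-- A homomorphism with open kernel onto a finite group is a generator of a shift if its
translates identify the pair with the sequences in the group. -/
theorem isIsomorphic_shift {F : Type u} [Group F] [Finite F] (p : P →* F)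
    (hp : IsOpen (p.ker : Set P)) (hbij : Function.Bijective fun (x : P) (k : ℤ) =>
      p (P.autPow k x)) : P.IsIsomorphic (shift F) := by
  let _ : TopologicalSpace F := ⊥
  have : DiscreteTopology F := ⟨rfl⟩
  have hpc : Continuous p := by
    rw [continuous_discrete_rng]
    intro q
    rcases (p ⁻¹' {q}).eq_empty_or_nonempty with h | ⟨x, rfl⟩
    · rw [h]
      exact isOpen_empty
    · have : p ⁻¹' {p x} = (fun y => x⁻¹ * y) ⁻¹' (p.ker : Set P) := by
        ext y
        change p y = p x ↔ p (x⁻¹ * y) = 1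
        rw [map_mul, map_inv, inv_mul_eq_one, eq_comm]
      rw [this]
      exact hp.preimage (by fun_prop)
  have hcont : Continuous (fun (x : P) (k : ℤ) => p (P.autPow k x)) :=
    continuous_pi fun k => hpc.comp (continuous_autPow k)
  let e : P ≃* (ℤ → F) :=
    { Equiv.ofBijective _ hbij with
      map_mul' := fun x y => funext fun k => by
        change p (P.autPow k (x * y)) = p (P.autPow k x) * p (P.autPow k y)
        rw [map_mul, map_mul] }
  refine ⟨({ e with
      continuous_toFun := hcont
      continuous_invFun :=
        Continuous.continuous_symm_of_equiv_compact_to_t2 (f := e.toEquiv) hcont } :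
      P ≃ₜ* (ℤ → F)), fun x => funext fun k => ?_⟩
  change p (P.autPow k (P.aut x)) = p (P.autPow (k + 1) x)
  rw [autPow_add, autPow_one]

/-- The alphabet of an irreducible shift is simple. -/
theorem IsIrreducible.isSimpleGroup (hP : P.IsIrreducible) {F : Type u} [Group F] (p : P →* F)
    (hp : IsOpen (p.ker : Set P)) (hbij : Function.Bijective fun (x : P) (k : ℤ) =>
      p (P.autPow k x)) : IsSimpleGroup F := by
  have := hP.1
  have hnt : Nontrivial F := by
    by_contra h
    rw [not_nontrivial_iff_subsingleton] at h
    obtain ⟨x, y, hxy⟩ := exists_pair_ne P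
    exact hxy (hbij.1 (Subsingleton.elim _ _))
  refine { exists_pair_ne := hnt.exists_pair_ne, eq_bot_or_eq_top_of_normal := fun J hJ => ?_ }
  have hJc : IsClosed (J.comap p : Set P) :=
    Subgroup.isClosed_of_isOpen _ (Subgroup.isOpen_mono (MonoidHom.ker_le_comap p J) hp)
  set N : P.StableSubgroup := .mk' (⨅ k : ℤ, (J.comap p).comap (P.autPow k).toMonoidHom)
    (by
      rw [Subgroup.coe_iInf]
      exact isClosed_iInter fun k => hJc.preimage (continuous_autPow k))
    (by
      intro k x hx
      rw [Subgroup.mem_iInf] at hx ⊢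
      intro j
      change p (P.autPow j (P.autPow k x)) ∈ J
      rw [autPow_autPow]
      exact hx (j + k))
  have hmem : ∀ {x : P}, x ∈ N.toSubgroup ↔ ∀ k, p (P.autPow k x) ∈ J := Subgroup.mem_iInf
  -- `N` corresponds to the sequences with values in `J`. If it is everything, constant sequences
  -- give `J = ⊤`. Otherwise it is finite, whereas a nontrivial `q ∈ J` would give infinitely many
  -- sequences equal to `q` at one place and `1` elsewhere.
  by_cases htop : N.toSubgroup = ⊤
  · right
    rw [eq_top_iff]
    intro q _
    obtain ⟨x, hx⟩ := hbij.2 fun _ => q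
    have h0 := hmem.1 (htop ▸ Subgroup.mem_top x) 0
    rwa [show p (P.autPow 0 x) = q from congrFun hx 0] at h0
  · left
    have hfin := hP.2 N (Subgroup.normal_iInf_normal fun k => (hJ.comap p).comap _) htop
    rw [Subgroup.eq_bot_iff_forall]
    intro q hq
    by_contra hq1
    choose g hg using fun j : ℤ => hbij.2 (Pi.mulSingle j q)
    have hgN : ∀ j, g j ∈ N.toSubgroup := fun j => hmem.2 fun k => by
      rw [show p (P.autPow k (g j)) = _ from congrFun (hg j) k]
      by_cases hk : k = j
      · rw [hk, Pi.mulSingle_eq_same]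
        exact hq
      · rw [Pi.mulSingle_eq_of_ne hk]
        exact J.one_mem
    have hinj : Function.Injective fun j : ℤ => (⟨g j, hgN j⟩ : N.toSubgroup) := by
      intro i j hij
      have h1 : g i = g j := congrArg Subtype.val hij
      have h2 : (Pi.mulSingle i q : ℤ → F) = Pi.mulSingle j q := by rw [← hg i, ← hg j, h1]
      by_contra hne
      apply hq1
      have h3 := congrFun h2 i
      rwa [Pi.mulSingle_eq_same, Pi.mulSingle_eq_of_ne hne] at h3
    exact not_finite_iff_infinite.2 inferInstance (Finite.of_injective _ hinj)

/-- A transitive irreducible pair of finite depth is the shift over a finite simple group. -/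
theorem IsIrreducible.exists_isIsomorphic_shift (hP : P.IsIrreducible)
    (ht : P.IsTopologicallyTransitive) (C : P.Coding) :
    ∃ (F : Type u) (_ : Group F) (_ : Finite F), IsSimpleGroup F ∧ P.IsIsomorphic (shift F) := by
  have := hP.1
  have hex : ∃ m : ℕ, ∃ a : ℤ, ∃ x ∈ C.kerOn (Set.Ico a (a + m))ᶜ, x ≠ 1 := by
    obtain ⟨x, ⟨⟨a, ha⟩, ⟨b, hb⟩⟩, hne⟩ := C.exists_ne_one_of_transitive ht
    refine ⟨(b - a).toNat, a, x, C.mem_kerOn.2 fun i hi => ?_, hne⟩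
    rcases lt_or_ge i a with hia | hia
    · exact C.mem_kerOn.1 ha i hia
    · refine C.mem_kerOn.1 hb i ?_
      simp only [Set.mem_compl_iff, Set.mem_Ico, Set.mem_Ici] at hi ⊢
      omega
  classical
  -- The least length of an interval supporting a nontrivial element.
  set m := Nat.find hex with hm
  obtain ⟨a, x, hx, hne⟩ := Nat.find_spec hex
  have hx0 : P.autPow a x ∈ C.kerOn (Set.Ico (0 : ℤ) (0 + m))ᶜ := by
    have := Coding.autPow_mem_kerOn_compl_Ico a hx
    rwa [sub_self] at this
  have hgen := Coding.gen_univ_eq_top hP hx0 fun h => hne ((P.autPow a).injective (by simpa using h))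
  -- Positivity lets the natural number `m - 1` agree with the integer length `m - 1` when
  -- minimality is applied below.
  have hmpos : m ≠ 0 := by
    intro h0
    refine hne (C.eq_one_of_coord fun i => C.mem_kerOn.1 hx i ?_)
    rw [← hm, h0]
    simp
  have hmin : ∀ a : ℤ, ∀ x ∈ C.kerOn (Set.Ico a (a + m - 1))ᶜ, x = 1 := by
    intro a x hx
    by_contra hne
    refine Nat.find_min hex (m := m - 1) (by omega) ⟨a, x, ?_, hne⟩
    have : a + ((m - 1 : ℕ) : ℤ) = a + m - 1 := by omega
    rwa [this]
  set p := QuotientGroup.mk' (C.genCompl m 0) with hp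
  have hker : IsOpen (p.ker : Set P) := by
    rw [hp, QuotientGroup.ker_mk']
    exact Coding.isOpen_genCompl hgen 0
  have : (C.genCompl m 0).FiniteIndex := Coding.finiteIndex_genCompl hgen 0
  have hbij : Function.Bijective fun (x : P) (k : ℤ) => p (P.autPow k x) := by
    constructor
    · intro x y hxy
      have : x⁻¹ * y = 1 := by
        refine Coding.eq_one_of_forall_mem_genCompl hgen hmin fun a => ?_
        have h1 : p (P.autPow a (x⁻¹ * y)) = 1 := by
          rw [map_mul, map_inv, map_mul, map_inv, inv_mul_eq_one]
          exact congrFun hxy a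
        have h2 : P.autPow a (x⁻¹ * y) ∈ C.genCompl m 0 := (QuotientGroup.eq_one_iff _).1 h1
        have h3 := Coding.autPow_mem_genCompl (k := -a) h2
        rwa [autPow_autPow, neg_add_cancel, autPow_zero, zero_sub, neg_neg] at h3
      exact inv_mul_eq_one.1 this
    · intro f
      obtain ⟨x, hx⟩ := Coding.exists_forall_mk_eq hgen f
      exact ⟨x, funext hx⟩
  exact ⟨P ⧸ C.genCompl m 0, inferInstance, inferInstance, hP.isSimpleGroup p hker hbij,
    isIsomorphic_shift p hker hbij⟩

/-- The subquotient gets its own coding from irreducibility and from having enough open normal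
subgroups, so no separate proof that finite depth passes to quotients is needed. -/
theorem SubnormalSeries.exists_isIsomorphic_shift (C : P.Coding) (S : P.SubnormalSeries)
    (hS : S.IsComposition) (j : Fin S.length) :
    ∃ (F : Type u) (_ : Group F) (_ : Finite F), IsSimpleGroup F ∧
      (S.subquotient j).IsIsomorphic (shift F) := by
  obtain ⟨C'⟩ := (hS j).nonempty_coding (C.exists_open_normal_subquotient _ _ (S.normal j))
  exact (hS j).exists_isIsomorphic_shift (S.transitive_quotient j) C'

end CompactPair

theorem theorem6p16 (P : CompactPair.{u}) (htrans : P.IsTopologicallyTransitive)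
    (hdepth : P.HasFiniteDepth) :
    (∃ S : P.SubnormalSeries, S.IsComposition) ∧
    (∀ S : P.SubnormalSeries, S.IsComposition → ∀ j : Fin S.length,
      ∃ (F : Type u) (_ : Group F) (_ : Finite F), IsSimpleGroup F ∧
        (S.subquotient j).IsIsomorphic (CompactPair.shift F)) ∧
    (∀ S T : P.SubnormalSeries, S.IsComposition → T.IsComposition → S.Equivalent T) := by
  obtain ⟨C⟩ := hdepth.nonempty_coding
  exact ⟨CompactPair.SubnormalSeries.exists_isComposition C htrans,
    fun S hS j => S.exists_isIsomorphic_shift C hS j,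
    fun _ _ hS hT => CompactPair.SubnormalSeries.equivalent_of_isComposition C hS hT⟩
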